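/- **Theorem.** Let $\Omega\subseteq\mathbb R^N$ be a bounded open set (no regularity of $\partial\Omega$ is assumed). For $1<p<\infty$ let $W^{1,p}_0(\Omega)$ be the closure of $C^\infty_c(\Omega)$ in $W^{1,p}(\Omega)$, and put $$W^{1,p_-}_0(\Omega)=W^{1,p}(\Omega)\cap\bigcap_{1<s<p}W^{1,s}_0(\Omega).$$ Define $\mathcal E_p,\underline{\mathcal E}_p:L^1_{loc}(\Omega)\to[0,+\infty]$ by $$\mathcal E_p(u)=\begin{cases}\left(\int_\Omega|\nabla u|^p\,dx\right)^{1/p}&\text{if }u\in W^{1,p}_0(\Omega),\\+\infty&\text{otherwise,}\end{cases}\qquad \underline{\mathcal E}_p(u)=\begin{cases}\left(\int_\Omega|\nabla u|^p\,dx\right)^{1/p}&\text{if }u\in W^{1,p_-}_0(\Omega),\\+\infty&\text{otherwise.}\end{cases}$$ Let $1<p<\infty$ and let $(p_h)_{h\in\mathbb N}$ be a sequence in $(1,\infty)$ strictly increasing to $p$. Then both $(\underline{\mathcal E}_{p_h})$ and $(\mathcal E_{p_h})$ $\Gamma$-converge to $\underline{\mathcal E}_p$ in $L^1_{loc}(\Omega)$,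 where $L^1_{loc}(\Omega)$ carries the topology of $L^1$-convergence on the compact subsets of $\Omega$. Here $(f_h)$ *$\Gamma$-converges to $f$* in a metrizable space $X$ if, for every $u\in X$, one has $\liminf_{h\to\infty} f_h(u_h)\ge f(u)$ for every sequence $u_h\to u$ in $X$, and there exists a sequence $u_h\to u$ in $X$ with $\lim_{h\to\infty} f_h(u_h)=f(u)$. -/

import Mathlib

open MeasureTheory Filter Topology
open scoped ENNReal

noncomputable section

/-- The space `L¹_loc(Ω)`: classes, modulo equality a.e. in `Ω`, of real functions which are locally
integrable on the open set `Ω ⊆ ℝᴺ` with respect to the Lebesgue measure. -/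
def L1loc {N : ℕ} (Ω : TopologicalSpace.Opens (EuclideanSpace ℝ (Fin N))) : Type :=
  {u : EuclideanSpace ℝ (Fin N) →ₘ[volume.restrict (Ω : Set (EuclideanSpace ℝ (Fin N)))] ℝ //
    LocallyIntegrableOn (fun x => u x) (Ω : Set (EuclideanSpace ℝ (Fin N))) volume}

namespace L1loc

variable {N : ℕ} {Ω : TopologicalSpace.Opens (EuclideanSpace ℝ (Fin N))}

instance : CoeFun (L1loc Ω) (fun _ => EuclideanSpace ℝ (Fin N) → ℝ) := ⟨fun u x => u.1 x⟩

/-- An element of `L¹_loc(Ω)` is integrable on each compact subset of `Ω`. -/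
theorem integrable_restrict (u : L1loc Ω) {K : Set (EuclideanSpace ℝ (Fin N))}
    (hK : IsCompact K) (hKΩ : K ⊆ Ω) : Integrable (fun x => u x) (volume.restrict K) :=
  u.2.integrableOn_compact_subset hKΩ hK

/-- The restriction map `L¹_loc(Ω) → L¹(K)`, for a compact subset `K` of `Ω`. -/
def restrictL1
    (K : {K : Set (EuclideanSpace ℝ (Fin N)) // IsCompact K ∧ K ⊆ (Ω : Set _)}) (u : L1loc Ω) :
    Lp ℝ 1 (volume.restrict K.1) :=
  (u.integrable_restrict K.2.1 K.2.2).toL1 (fun x => u x)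

/-- The usual topology of `L¹_loc(Ω)`: convergence in `L¹(K)` for every compact `K ⊆ Ω`, i.e. the
coarsest topology such that all the restriction maps `L¹_loc(Ω) → L¹(K)` are continuous. -/
instance : TopologicalSpace (L1loc Ω) :=
  ⨅ K : {K : Set (EuclideanSpace ℝ (Fin N)) // IsCompact K ∧ K ⊆ (Ω : Set _)},
    TopologicalSpace.induced (restrictL1 K) inferInstance

end L1loc

/-- `G` is the weak (distributional) gradient of `u` in `Ω`: it is locally integrable on `Ω` and
`∫_Ω u ∇φ dx = - ∫_Ω φ G dx` for every `φ ∈ C_c^∞(Ω)` (an identity between vectors of `ℝᴺ`). -/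
def HasWeakGradient {N : ℕ} {Ω : TopologicalSpace.Opens (EuclideanSpace ℝ (Fin N))}
    (u : L1loc Ω) (G : EuclideanSpace ℝ (Fin N) → EuclideanSpace ℝ (Fin N)) : Prop :=
  LocallyIntegrableOn G (Ω : Set (EuclideanSpace ℝ (Fin N))) volume ∧
    ∀ φ : TestFunction Ω ℝ (⊤ : ℕ∞),
      ∫ x in (Ω : Set (EuclideanSpace ℝ (Fin N))), u x • gradient (fun y => φ y) x =
        - ∫ x in (Ω : Set (EuclideanSpace ℝ (Fin N))), φ x • G x

open Classical in
/-- The weak gradient `∇u`, determined up to equality a.e. in `Ω` (and `0` by convention if `u` has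
no weak gradient). -/
def weakGradient {N : ℕ} {Ω : TopologicalSpace.Opens (EuclideanSpace ℝ (Fin N))}
    (u : L1loc Ω) : EuclideanSpace ℝ (Fin N) → EuclideanSpace ℝ (Fin N) :=
  if h : ∃ G, HasWeakGradient u G then h.choose else 0

/-- The Sobolev space `W^{1,p}(Ω)`, as a subset of `L¹_loc(Ω)`: functions in `L^p(Ω)` which have a
weak gradient in `L^p(Ω)`. -/
def W1 {N : ℕ} (Ω : TopologicalSpace.Opens (EuclideanSpace ℝ (Fin N))) (p : ℝ) :
    Set (L1loc Ω) :=
  {u | MemLp (fun x => u x) (ENNReal.ofReal p)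
        (volume.restrict (Ω : Set (EuclideanSpace ℝ (Fin N)))) ∧
      ∃ G, HasWeakGradient u G ∧
        MemLp G (ENNReal.ofReal p) (volume.restrict (Ω : Set (EuclideanSpace ℝ (Fin N))))}

/-- The space `W^{1,p}_0(Ω)`: the closure of `C_c^∞(Ω)` in `W^{1,p}(Ω)`. -/
def W10 {N : ℕ} (Ω : TopologicalSpace.Opens (EuclideanSpace ℝ (Fin N))) (p : ℝ) :
    Set (L1loc Ω) :=
  {u | u ∈ W1 Ω p ∧ ∀ ε : ℝ≥0∞, 0 < ε → ∃ φ : TestFunction Ω ℝ (⊤ : ℕ∞),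
      eLpNorm (fun x => u x - φ x) (ENNReal.ofReal p)
        (volume.restrict (Ω : Set (EuclideanSpace ℝ (Fin N)))) < ε ∧
      eLpNorm (fun x => weakGradient u x - gradient (fun y => φ y) x) (ENNReal.ofReal p)
        (volume.restrict (Ω : Set (EuclideanSpace ℝ (Fin N)))) < ε}

/-- The space `W^{1,p_-}_0(Ω) = W^{1,p}(Ω) ∩ ⋂_{1<s<p} W^{1,s}_0(Ω)`. -/
def W10minus {N : ℕ} (Ω : TopologicalSpace.Opens (EuclideanSpace ℝ (Fin N))) (p : ℝ) :
    Set (L1loc Ω) :=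
  W1 Ω p ∩ ⋂ s ∈ Set.Ioo 1 p, W10 Ω s

open Classical in
/-- The functional on `L¹_loc(Ω)` equal to `(∫_Ω |∇u|^p dx)^{1/p}` if `u ∈ W`, and to `+∞`
otherwise. -/
def dirichletEnergyOn {N : ℕ} {Ω : TopologicalSpace.Opens (EuclideanSpace ℝ (Fin N))}
    (W : Set (L1loc Ω)) (p : ℝ) (u : L1loc Ω) : ℝ≥0∞ :=
  if u ∈ W then
    (∫⁻ x in (Ω : Set (EuclideanSpace ℝ (Fin N))), ‖weakGradient u x‖ₑ ^ p) ^ (1 / p)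
  else ⊤

/-- The functional `𝓔_p : L¹_loc(Ω) → [0,+∞]`, finite on `W^{1,p}_0(Ω)`. -/
def energy {N : ℕ} (Ω : TopologicalSpace.Opens (EuclideanSpace ℝ (Fin N))) (p : ℝ) :
    L1loc Ω → ℝ≥0∞ :=
  dirichletEnergyOn (W10 Ω p) p

/-- The functional `𝓔̲_p : L¹_loc(Ω) → [0,+∞]`, finite on `W^{1,p_-}_0(Ω)`. -/
def energyMinus {N : ℕ} (Ω : TopologicalSpace.Opens (EuclideanSpace ℝ (Fin N))) (p : ℝ) :
    L1loc Ω → ℝ≥0∞ :=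
  dirichletEnergyOn (W10minus Ω p) p

/-- (Sequential) `Γ`-convergence of a sequence of functions `F h : X → [0,+∞]` to `f`. -/
def GammaConverges {X : Type*} [TopologicalSpace X] (F : ℕ → X → ℝ≥0∞) (f : X → ℝ≥0∞) : Prop :=
  (∀ (u : X) (v : ℕ → X), Tendsto v atTop (𝓝 u) →
      f u ≤ liminf (fun h => F h (v h)) atTop) ∧
    ∀ u : X, ∃ v : ℕ → X, Tendsto v atTop (𝓝 u) ∧
      Tendsto (fun h => F h (v h)) atTop (𝓝 (f u))

end

/-! Since `energyMinus` is at most `energy` at each exponent, it is enough to prove the liminf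
inequality for `energyMinus` and, along constant sequences, the limsup inequality for `energy`. The
latter is Hölder's inequality on a set of finite measure: an element of `W10minus Ω p` lies in `W10
Ω q` for every q in (1, p), and the Hölder factor c^(1/q - 1/p) tends to 1 as q increases to p
(`limsup_energy_le`).

For the liminf inequality, let v_h → u with energies below M along a subsequence. By Hölder the
gradients are eventually bounded in L^s for each s < p, and the task is to place u in `W10 Ω t` for
each t in (1, p), with a bound that is sharp as t → p. Instead of weak compactness and Mazur's
lemma, good convex combinations are chosen directly: almost minimisers of the strictly convex
functional ∫ √(1 + |∇w|²) on the convex hulls of the tails of the sequence. The infima increase and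
stay bounded, so the convexity defects at midpoints vanish (`exists_seq_midpoint_defect_small`).
Quantitative strict convexity (`norm_sub_sq_le_sqrt_defect`), interpolated with the L^s bound, turns
this into a Cauchy property of the gradients in L^t for t < s
(`cauchy_eLpNorm_of_midpoint_defect_small`). Poincaré's inequality makes the functions Cauchy too,
and since tail hulls still converge to u in L¹ on compact sets, the limit is u
(`mem_W10_of_tendsto`).

Finally t = q_k increases to p and Fatou's lemma gives the bounds in L^p
(`eLpNorm_le_of_tendsto_exponent`). Only the membership in W^{1,t}_0 with t < p is obtained, which
is why the limit functional lives on `W10minus Ω p`. -/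

noncomputable section

/-! ### Almost minimisers and quantitative strict convexity -/

/-- In a decreasing sequence of convex sets, on which `Φ` is bounded, points can be chosen so that
the defect of convexity of `Φ` at their midpoints tends to `0`. -/
theorem exists_seq_midpoint_defect_small {V : Type*} [AddCommGroup V] [Module ℝ V]
    {C : ℕ → Set V} (hconv : ∀ n, Convex ℝ (C n)) (hne : ∀ n, (C n).Nonempty)
    (hanti : Antitone C) (Φ : V → ℝ) {B : ℝ} (h0 : ∀ x, 0 ≤ Φ x)
    (hB : ∀ n, ∀ x ∈ C n, Φ x ≤ B) :
    ∃ x : ℕ → V, (∀ n, x n ∈ C n) ∧ ∀ ε : ℝ, 0 < ε → ∃ n₀, ∀ n ≥ n₀, ∀ m ≥ n₀,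
      Φ (x n) + Φ (x m) - 2 * Φ ((1 / 2 : ℝ) • (x n + x m)) < ε := by
  have hbdd : ∀ n, BddBelow (Φ '' C n) := fun n => ⟨0, by rintro _ ⟨x, -, rfl⟩; exact h0 x⟩
  set d : ℕ → ℝ := fun n => sInf (Φ '' C n) with hd
  have hmono : Monotone d := fun n m hnm =>
    csInf_le_csInf (hbdd n) ((hne m).image Φ) (Set.image_mono (hanti hnm))
  have hdB : BddAbove (Set.range d) := by
    refine ⟨B, ?_⟩
    rintro _ ⟨n, rfl⟩
    obtain ⟨x, hx⟩ := hne n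
    exact (csInf_le (hbdd n) ⟨x, hx, rfl⟩).trans (hB n x hx)
  have hx : ∀ n : ℕ, ∃ x ∈ C n, Φ x < d n + 1 / ((n : ℝ) + 1) := by
    intro n
    obtain ⟨_, ⟨x, hx, rfl⟩, h⟩ := exists_lt_of_csInf_lt ((hne n).image Φ)
      (lt_add_of_pos_right (sInf (Φ '' C n)) (Nat.one_div_pos_of_nat (α := ℝ) (n := n)))
    exact ⟨x, hx, h⟩
  choose x hxC hxΦ using hx
  refine ⟨x, hxC, fun ε hε => ?_⟩
  -- The infima `d n` increase to a finite supremum S. From some index on, each of the two points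
  -- costs less than S + ε/4 and their midpoint, which lies in the larger set `C n₀`, costs more
  -- than S - ε/4, so the defect is below 4 · ε/4.
  have h1 := (tendsto_atTop_ciSup hmono hdB).eventually_const_lt
    (show (⨆ n, d n) - ε / 4 < ⨆ n, d n by linarith)
  have h2 := (tendsto_one_div_add_atTop_nhds_zero_nat (𝕜 := ℝ)).eventually_lt_const
    (show (0 : ℝ) < ε / 4 by linarith)
  obtain ⟨n₀, h1, h2⟩ := (h1.and h2).exists
  refine ⟨n₀, fun n hn m hm => ?_⟩
  have key : ∀ k ≥ n₀, Φ (x k) < (⨆ n, d n) + ε / 4 := by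
    intro k hk
    have := hxΦ k
    have h3 := le_ciSup hdB k
    have h4 : 1 / ((k : ℝ) + 1) ≤ 1 / ((n₀ : ℝ) + 1) := Nat.one_div_le_one_div hk
    linarith
  have hmid : (1 / 2 : ℝ) • (x n + x m) ∈ C n₀ := by
    rw [smul_add]
    exact hconv n₀ (hanti hn (hxC n)) (hanti hm (hxC m)) (by norm_num) (by norm_num) (by norm_num)
  have := csInf_le (hbdd n₀) ⟨_, hmid, rfl⟩
  have h5 := key n hn
  have h6 := key m hm
  change d n₀ ≤ _ at this
  linarith

/-- Quantitative strict convexity of `x ↦ √(1 + ‖x‖ ^ 2)`. -/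
theorem norm_sub_sq_le_sqrt_defect {F : Type*} [NormedAddCommGroup F] [InnerProductSpace ℝ F]
    (a b : F) :
    ‖a - b‖ ^ 2 ≤ (√(1 + ‖a‖ ^ 2) + √(1 + ‖b‖ ^ 2) - 2 * √(1 + ‖(1 / 2 : ℝ) • (a + b)‖ ^ 2)) *
      (√(1 + ‖a‖ ^ 2) + √(1 + ‖b‖ ^ 2)) ^ 3 := by
  set A := √(1 + ‖a‖ ^ 2)
  set B := √(1 + ‖b‖ ^ 2)
  set M := √(1 + ‖(1 / 2 : ℝ) • (a + b)‖ ^ 2)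
  have hA : A ^ 2 = 1 + ‖a‖ ^ 2 := Real.sq_sqrt (by positivity)
  have hB : B ^ 2 = 1 + ‖b‖ ^ 2 := Real.sq_sqrt (by positivity)
  have hM : (2 * M) ^ 2 = 4 + ‖a + b‖ ^ 2 := by
    rw [mul_pow, Real.sq_sqrt (by positivity), norm_smul]
    norm_num
    ring
  have hA0 : 0 < A := Real.sqrt_pos.2 (by positivity)
  have hB0 : 0 < B := Real.sqrt_pos.2 (by positivity)
  have hM0 : 0 ≤ M := Real.sqrt_nonneg _
  have hadd := norm_add_sq_real a b
  have hsub := norm_sub_sq_real a b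
  have hcs := real_inner_mul_inner_self_le a b
  rw [real_inner_self_eq_norm_sq, real_inner_self_eq_norm_sq] at hcs
  set c := inner ℝ a b
  -- The difference of the two sides is |a|²|b|² - c², nonnegative by Cauchy–Schwarz.
  have h1 : ‖a - b‖ ^ 2 ≤ (A * B - (1 + c)) * (A * B + (1 + c)) := by
    have : (A * B - (1 + c)) * (A * B + (1 + c)) = A ^ 2 * B ^ 2 - (1 + c) ^ 2 := by ring
    rw [this, hA, hB, hsub]
    nlinarith
  have hc : 1 + c ≤ A * B := by
    refine abs_le_of_sq_le_sq' (a := 1 + c) ?_ (by positivity) |>.2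
    have : (A * B - (1 + c)) * (A * B + (1 + c)) = (A * B) ^ 2 - (1 + c) ^ 2 := by ring
    nlinarith [sq_nonneg ‖a - b‖]
  -- Multiplying by the conjugate sum removes the square roots from the defect.
  have hST : (A + B - 2 * M) * (A + B + 2 * M) = 2 * (A * B - (1 + c)) := by
    have : (A + B - 2 * M) * (A + B + 2 * M) = A ^ 2 + B ^ 2 + 2 * (A * B) - (2 * M) ^ 2 := by ring
    rw [this, hM, hA, hB, hadd]
    ring
  have hTS : 2 * M ≤ A + B := by
    by_contra h
    push Not at h
    have : (A + B - 2 * M) * (A + B + 2 * M) < 0 :=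
      mul_neg_of_neg_of_pos (by linarith) (by linarith)
    linarith
  have h2 : A * B + (1 + c) ≤ (A + B) ^ 2 / 2 := by nlinarith [sq_nonneg (A - B)]
  calc ‖a - b‖ ^ 2 ≤ (A * B - (1 + c)) * (A * B + (1 + c)) := h1
    _ ≤ (A * B - (1 + c)) * ((A + B) ^ 2 / 2) :=
        mul_le_mul_of_nonneg_left h2 (by linarith)
    _ = (A + B - 2 * M) * (A + B + 2 * M) * ((A + B) ^ 2 / 4) := by rw [hST]; ring
    _ ≤ (A + B - 2 * M) * (2 * (A + B)) * ((A + B) ^ 2 / 4) := by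
        gcongr
        linarith
    _ ≤ (A + B - 2 * M) * (A + B) ^ 3 := by
        have : 0 ≤ (A + B - 2 * M) * (A + B) ^ 3 := mul_nonneg (by linarith) (by positivity)
        nlinarith

/-- Split |a - b|^t as (|a - b|²)^θ |a - b|^(t - 2θ), and bound the first base by D X³ and the
second by X, where D is the defect and X the sum of the two roots. The result is D^θ X^(t + θ), and
θ = (s - t)/(1 + s) is the value for which t + θ = s(1 - θ), the form required by Hölder's
inequality with an L^s bound on X. -/
theorem norm_sub_rpow_le_sqrt_defect {F : Type*} [NormedAddCommGroup F] [InnerProductSpace ℝ F]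
    (a b : F) {s t : ℝ} (ht : 1 ≤ t) (hts : t < s) (hst : s ≤ t + 1) :
    ‖a - b‖ ^ t ≤
      (√(1 + ‖a‖ ^ 2) + √(1 + ‖b‖ ^ 2) - 2 * √(1 + ‖(1 / 2 : ℝ) • (a + b)‖ ^ 2)) ^
          ((s - t) / (1 + s)) *
        ((√(1 + ‖a‖ ^ 2) + √(1 + ‖b‖ ^ 2)) ^ s) ^ (1 - (s - t) / (1 + s)) := by
  have hle := norm_sub_sq_le_sqrt_defect a b
  have hnorm : ‖a - b‖ ≤ √(1 + ‖a‖ ^ 2) + √(1 + ‖b‖ ^ 2) := by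
    refine (norm_sub_le a b).trans (add_le_add ?_ ?_) <;>
      exact Real.le_sqrt_of_sq_le (by linarith)
  have hX : 0 < √(1 + ‖a‖ ^ 2) + √(1 + ‖b‖ ^ 2) := by positivity
  set X := √(1 + ‖a‖ ^ 2) + √(1 + ‖b‖ ^ 2)
  set D := X - 2 * √(1 + ‖(1 / 2 : ℝ) • (a + b)‖ ^ 2)
  set θ := (s - t) / (1 + s) with hθ
  have hs : 0 < 1 + s := by linarith
  have hθ0 : 0 < θ := div_pos (by linarith) hs
  have hθ1 : θ ≤ 1 / 2 := by
    rw [hθ, div_le_div_iff₀ hs two_pos]; linarith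
  have hθs : s * (1 - θ) = t + θ := by rw [hθ]; field_simp; ring
  have hD : 0 ≤ D := by
    by_contra h
    push Not at h
    nlinarith [sq_nonneg ‖a - b‖, mul_neg_of_neg_of_pos h (pow_pos hX 3)]
  calc ‖a - b‖ ^ t = (‖a - b‖ ^ 2) ^ θ * ‖a - b‖ ^ (t - 2 * θ) := by
        rw [← Real.rpow_natCast, ← Real.rpow_mul (norm_nonneg _),
          ← Real.rpow_add_of_nonneg (norm_nonneg _) (by push_cast; linarith) (by linarith)]
        congr 1
        push_cast
        ring
    _ ≤ (D * X ^ 3) ^ θ * X ^ (t - 2 * θ) := by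
        gcongr
        linarith
    _ = D ^ θ * (X ^ s) ^ (1 - θ) := by
        rw [Real.mul_rpow hD (by positivity), ← Real.rpow_natCast, ← Real.rpow_mul hX.le,
          ← Real.rpow_mul hX.le, mul_assoc, ← Real.rpow_add hX, hθs]
        congr 2
        push_cast
        ring

theorem MeasureTheory.Integrable.sqrt_one_add_norm_sq {α F : Type*} [MeasurableSpace α]
    {μ : Measure α} [IsFiniteMeasure μ] [NormedAddCommGroup F] {a : α → F} (ha : Integrable a μ) :
    Integrable (fun x => √(1 + ‖a x‖ ^ 2)) μ := by
  refine ((integrable_const (1 : ℝ)).add ha.norm).mono' ?_ (ae_of_all _ fun x => ?_)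
  · exact Real.continuous_sqrt.comp_aestronglyMeasurable
      (aestronglyMeasurable_const.add (ha.1.norm.pow 2))
  · rw [Real.norm_of_nonneg (Real.sqrt_nonneg _)]
    simp only [Pi.add_apply]
    refine Real.sqrt_le_iff.2 ⟨by positivity, ?_⟩
    nlinarith [norm_nonneg (a x)]

/-- The pointwise estimate is integrated by Hölder's inequality with weights θ and 1 - θ; the defect
is integrated to the power 1 only, so its integral is the defect of the functional. -/
theorem lintegral_enorm_sub_rpow_le {α F : Type*} [MeasurableSpace α] {μ : Measure α}
    [IsFiniteMeasure μ] [NormedAddCommGroup F] [InnerProductSpace ℝ F] {a b : α → F}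
    (ha : Integrable a μ) (hb : Integrable b μ) {s t : ℝ} (ht : 1 ≤ t) (hts : t < s)
    (hst : s ≤ t + 1) :
    ∫⁻ x, ‖a x - b x‖ₑ ^ t ∂μ ≤
      ENNReal.ofReal (∫ x, √(1 + ‖a x‖ ^ 2) ∂μ + ∫ x, √(1 + ‖b x‖ ^ 2) ∂μ -
          2 * ∫ x, √(1 + ‖(1 / 2 : ℝ) • (a x + b x)‖ ^ 2) ∂μ) ^ ((s - t) / (1 + s)) *
        (∫⁻ x, ENNReal.ofReal (√(1 + ‖a x‖ ^ 2) + √(1 + ‖b x‖ ^ 2)) ^ s ∂μ) ^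
          (1 - (s - t) / (1 + s)) := by
  have hs : 0 < 1 + s := by linarith
  have hθ0 : 0 < (s - t) / (1 + s) := div_pos (by linarith) hs
  have hθ1 : (s - t) / (1 + s) ≤ 1 / 2 := by rw [div_le_div_iff₀ hs two_pos]; linarith
  have hia := ha.sqrt_one_add_norm_sq
  have hib := hb.sqrt_one_add_norm_sq
  have him := ((ha.add hb).smul (1 / 2 : ℝ)).sqrt_one_add_norm_sq
  simp only [Pi.smul_apply, Pi.add_apply] at him
  have hD : ∀ x, 0 ≤ √(1 + ‖a x‖ ^ 2) + √(1 + ‖b x‖ ^ 2) -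
      2 * √(1 + ‖(1 / 2 : ℝ) • (a x + b x)‖ ^ 2) := by
    intro x
    have h := norm_sub_sq_le_sqrt_defect (a x) (b x)
    have hX : 0 < √(1 + ‖a x‖ ^ 2) + √(1 + ‖b x‖ ^ 2) := by positivity
    by_contra h'
    push Not at h'
    nlinarith [sq_nonneg ‖a x - b x‖, mul_neg_of_neg_of_pos h' (pow_pos hX 3)]
  have hiab : Integrable (fun x => √(1 + ‖a x‖ ^ 2) + √(1 + ‖b x‖ ^ 2)) μ := hia.add hib
  have hiD : Integrable (fun x => √(1 + ‖a x‖ ^ 2) + √(1 + ‖b x‖ ^ 2) -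
      2 * √(1 + ‖(1 / 2 : ℝ) • (a x + b x)‖ ^ 2)) μ := hiab.sub (him.const_mul 2)
  rw [← integral_add hia hib, ← integral_const_mul, ← integral_sub hiab
    (him.const_mul 2), ofReal_integral_eq_lintegral_ofReal hiD
    (ae_of_all _ hD)]
  refine le_trans (lintegral_mono fun x => ?_) (ENNReal.lintegral_mul_norm_pow_le ?_ ?_ hθ0.le
    (by linarith) (by ring))
  · have := ENNReal.ofReal_le_ofReal (norm_sub_rpow_le_sqrt_defect (a x) (b x) ht hts hst)
    rw [ENNReal.ofReal_mul (Real.rpow_nonneg (hD x) _),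
      ← ENNReal.ofReal_rpow_of_nonneg (norm_nonneg _) (by linarith),
      ← ENNReal.ofReal_rpow_of_nonneg (hD x) hθ0.le,
      ← ENNReal.ofReal_rpow_of_nonneg (by positivity) (by linarith),
      ← ENNReal.ofReal_rpow_of_nonneg (by positivity) (by linarith),
      ofReal_norm] at this
    exact this
  · exact hiD.1.aemeasurable.ennreal_ofReal
  · exact hiab.1.aemeasurable.ennreal_ofReal.pow_const _

theorem eLpNorm_sqrt_one_add_norm_sq_add_le {α F : Type*} [MeasurableSpace α] {μ : Measure α}
    [IsFiniteMeasure μ] [NormedAddCommGroup F] {a b : α → F} {s : ℝ≥0∞} (hs : 1 ≤ s)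
    (ha : AEStronglyMeasurable a μ) (hb : AEStronglyMeasurable b μ) :
    eLpNorm (fun x => √(1 + ‖a x‖ ^ 2) + √(1 + ‖b x‖ ^ 2)) s μ ≤
      eLpNorm (fun _ => (2 : ℝ)) s μ + eLpNorm a s μ + eLpNorm b s μ := by
  have h : ∀ c : F, √(1 + ‖c‖ ^ 2) ≤ 1 + ‖c‖ := fun c =>
    Real.sqrt_le_iff.2 ⟨by positivity, by nlinarith [norm_nonneg c]⟩
  calc _ ≤ eLpNorm (((fun _ => (2 : ℝ)) + fun x => ‖a x‖) + fun x => ‖b x‖) s μ := by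
        refine eLpNorm_mono_real fun x => ?_
        rw [Real.norm_of_nonneg (by positivity)]
        simp only [Pi.add_apply]
        linarith [h (a x), h (b x)]
    _ ≤ eLpNorm ((fun _ => (2 : ℝ)) + fun x => ‖a x‖) s μ + eLpNorm (fun x => ‖b x‖) s μ :=
        eLpNorm_add_le (aestronglyMeasurable_const.add ha.norm) hb.norm hs
    _ ≤ _ := by
        rw [eLpNorm_norm, ← eLpNorm_norm a]
        gcongr
        exact eLpNorm_add_le aestronglyMeasurable_const ha.norm hs

/-- A sequence bounded in `L^s` for which the convexity defects of `∫ √(1 + ‖·‖ ^ 2)` at the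
midpoints tend to `0` is a Cauchy sequence in `L^t`, `t < s`. -/
theorem cauchy_eLpNorm_of_midpoint_defect_small {α F : Type*} [MeasurableSpace α] {μ : Measure α}
    [IsFiniteMeasure μ] [NormedAddCommGroup F] [InnerProductSpace ℝ F] {a : ℕ → α → F}
    {s t : ℝ} (ht : 1 ≤ t) (hts : t < s) (hst : s ≤ t + 1)
    (ha : ∀ n, MemLp (a n) (ENNReal.ofReal s) μ) {B : ℝ≥0∞} (hB : B ≠ ⊤)
    (haB : ∀ n, eLpNorm (a n) (ENNReal.ofReal s) μ ≤ B)
    (hdef : ∀ ε : ℝ, 0 < ε → ∃ n₀, ∀ n ≥ n₀, ∀ m ≥ n₀,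
      ∫ x, √(1 + ‖a n x‖ ^ 2) ∂μ + ∫ x, √(1 + ‖a m x‖ ^ 2) ∂μ -
        2 * ∫ x, √(1 + ‖(1 / 2 : ℝ) • (a n x + a m x)‖ ^ 2) ∂μ < ε)
    {ε : ℝ≥0∞} (hε : 0 < ε) :
    ∃ n₀, ∀ n ≥ n₀, ∀ m ≥ n₀, eLpNorm (a n - a m) (ENNReal.ofReal t) μ < ε := by
  have hs1 : 1 < s := by linarith
  have hs : 0 < 1 + s := by linarith
  have ht0 : 0 < t := by linarith
  have hθ0 : 0 < (s - t) / (1 + s) := div_pos (by linarith) hs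
  have hθ1 : (s - t) / (1 + s) ≤ 1 / 2 := by rw [div_le_div_iff₀ hs two_pos]; linarith
  have hsE : 1 ≤ ENNReal.ofReal s := ENNReal.one_le_ofReal.2 hs1.le
  set K : ℝ≥0∞ := (eLpNorm (fun _ => (2 : ℝ)) (ENNReal.ofReal s) μ + B + B) ^ s with hK
  have hKtop : K ≠ ⊤ := by
    refine ENNReal.rpow_ne_top_of_nonneg (by linarith) ?_
    have := (memLp_const (2 : ℝ) (μ := μ) (p := ENNReal.ofReal s)).eLpNorm_ne_top
    finiteness
  have hXK : ∀ n m, ∫⁻ x, ENNReal.ofReal (√(1 + ‖a n x‖ ^ 2) + √(1 + ‖a m x‖ ^ 2)) ^ s ∂μ ≤ K := by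
    intro n m
    have h := (eLpNorm_sqrt_one_add_norm_sq_add_le hsE (ha n).1 (ha m).1).trans
      (add_le_add (add_le_add le_rfl (haB n)) (haB m))
    rw [eLpNorm_eq_lintegral_rpow_enorm_toReal (by simp; linarith) ENNReal.ofReal_ne_top,
      ENNReal.toReal_ofReal (by linarith), one_div,
      ENNReal.rpow_inv_le_iff (by linarith)] at h
    convert h using 3 with x
    rw [Real.enorm_eq_ofReal (by positivity)]
  have hlim : Tendsto (fun δ : ℝ => ENNReal.ofReal δ ^ ((s - t) / (1 + s)) *
      K ^ (1 - (s - t) / (1 + s))) (𝓝[>] 0) (𝓝 0) := by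
    have h0 : Tendsto (fun δ : ℝ => ENNReal.ofReal δ ^ ((s - t) / (1 + s))) (𝓝[>] 0) (𝓝 0) := by
      have : Continuous fun δ : ℝ => ENNReal.ofReal δ ^ ((s - t) / (1 + s)) :=
        (ENNReal.continuous_rpow_const).comp ENNReal.continuous_ofReal
      have := (this.tendsto 0).mono_left (nhdsWithin_le_nhds (s := Set.Ioi 0))
      simpa [ENNReal.zero_rpow_of_pos hθ0] using this
    have := ENNReal.Tendsto.mul_const (b := K ^ (1 - (s - t) / (1 + s))) h0
      (Or.inr (ENNReal.rpow_ne_top_of_nonneg (by linarith) hKtop))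
    simpa using this
  have hεt : 0 < ε ^ t := ENNReal.rpow_pos_of_nonneg hε ht0.le
  obtain ⟨δ, hδ, hδ0⟩ := ((hlim.eventually_lt_const hεt).and self_mem_nhdsWithin).exists
  obtain ⟨n₀, hn₀⟩ := hdef δ hδ0
  refine ⟨n₀, fun n hn m hm => ?_⟩
  rw [eLpNorm_eq_lintegral_rpow_enorm_toReal (by simpa using ht0) ENNReal.ofReal_ne_top,
      ENNReal.toReal_ofReal ht0.le, one_div, ENNReal.rpow_inv_lt_iff ht0]
  refine lt_of_le_of_lt ?_ hδ
  refine (lintegral_enorm_sub_rpow_le ((ha n).integrable hsE) ((ha m).integrable hsE)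
    ht hts hst).trans ?_
  gcongr
  · exact (hn₀ n hn m hm).le
  · linarith
  · exact hXK n m

/-! ### Completeness of L^p and passage to the limit in the exponent -/

/-- Completeness of `L^p`, for functions. -/
theorem exists_tendsto_eLpNorm_of_cauchy {α F : Type*} [MeasurableSpace α] {μ : Measure α}
    [NormedAddCommGroup F] [CompleteSpace F] {p : ℝ≥0∞} (hp : 1 ≤ p) {f : ℕ → α → F}
    (hf : ∀ n, MemLp (f n) p μ)
    (hc : ∀ ε : ℝ≥0∞, 0 < ε → ∃ n₀, ∀ n ≥ n₀, ∀ m ≥ n₀, eLpNorm (f n - f m) p μ < ε) :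
    ∃ g, MemLp g p μ ∧ Tendsto (fun n => eLpNorm (f n - g) p μ) atTop (𝓝 0) := by
  have : Fact (1 ≤ p) := ⟨hp⟩
  have hcau : CauchySeq fun n => (hf n).toLp (f n) := by
    refine EMetric.cauchySeq_iff.2 fun ε hε => ?_
    obtain ⟨n₀, h⟩ := hc ε hε
    exact ⟨n₀, fun n hn m hm => by rw [Lp.edist_toLp_toLp]; exact h n hn m hm⟩
  obtain ⟨g, hg⟩ := cauchySeq_tendsto_of_complete hcau
  refine ⟨g, Lp.memLp g, ?_⟩
  rw [Lp.tendsto_Lp_iff_tendsto_eLpNorm'] at hg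
  refine hg.congr fun n => eLpNorm_congr_ae ?_
  exact (hf n).coeFn_toLp.sub (ae_eq_refl _)

/-- Lower semicontinuity of the `L^q` norm with respect to the exponent. -/
theorem eLpNorm_le_of_tendsto_exponent {α F : Type*} [MeasurableSpace α] {μ : Measure α}
    [NormedAddCommGroup F] {f : α → F} (hf : AEStronglyMeasurable f μ) {q : ℕ → ℝ} {p : ℝ}
    (hq : ∀ k, 0 < q k) (hp : 0 < p) (hqp : Tendsto q atTop (𝓝 p)) {a : ℕ → ℝ≥0∞} {b : ℝ≥0∞}
    (hb0 : b ≠ 0) (hb : b ≠ ⊤) (hab : Tendsto a atTop (𝓝 b))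
    (h : ∀ k, eLpNorm f (ENNReal.ofReal (q k)) μ ≤ a k) :
    eLpNorm f (ENNReal.ofReal p) μ ≤ b := by
  have hpow : ∀ c : ℝ≥0∞, Tendsto (fun k => c ^ q k) atTop (𝓝 (c ^ p)) := by
    intro c
    rcases eq_or_ne c 0 with rfl | hc0
    · simp [ENNReal.zero_rpow_of_pos, hp, hq]
    rcases eq_or_ne c ⊤ with rfl | hc
    · simp [ENNReal.top_rpow_of_pos, hp, hq]
    lift c to NNReal using hc
    have hc0 : c ≠ 0 := by simpa using hc0
    simp only [← ENNReal.coe_rpow_of_ne_zero hc0]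
    exact ENNReal.tendsto_coe.2 (tendsto_const_nhds.nnrpow hqp (Or.inl hc0))
  have hapow : Tendsto (fun k => a k ^ q k) atTop (𝓝 (b ^ p)) := by
    lift b to NNReal using hb
    have hb0 : b ≠ 0 := by simpa using hb0
    have ha : ∀ᶠ k in atTop, a k ≠ ⊤ := hab.eventually_ne ENNReal.coe_ne_top
    have h1 : Tendsto (fun k => (a k).toNNReal) atTop (𝓝 b) :=
      (ENNReal.tendsto_toNNReal ENNReal.coe_ne_top).comp hab
    have h2 := ENNReal.tendsto_coe.2 (h1.nnrpow hqp (Or.inl hb0))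
    rw [ENNReal.coe_rpow_of_ne_zero hb0] at h2
    refine h2.congr' ?_
    filter_upwards [ha] with k hk
    rw [ENNReal.coe_rpow_of_nonneg _ (hq k).le, ENNReal.coe_toNNReal hk]
  have hle : ∀ k, ∫⁻ x, ‖f x‖ₑ ^ q k ∂μ ≤ a k ^ q k := by
    intro k
    have := h k
    rwa [eLpNorm_eq_lintegral_rpow_enorm_toReal (by simpa using hq k) ENNReal.ofReal_ne_top,
      ENNReal.toReal_ofReal (hq k).le, one_div, ENNReal.rpow_inv_le_iff (hq k)] at this
  rw [eLpNorm_eq_lintegral_rpow_enorm_toReal (by simpa using hp) ENNReal.ofReal_ne_top,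
    ENNReal.toReal_ofReal hp.le, one_div, ENNReal.rpow_inv_le_iff hp]
  -- Fatou's lemma, applied to |f|^(q k), which converges pointwise to |f|^p.
  calc ∫⁻ x, ‖f x‖ₑ ^ p ∂μ = ∫⁻ x, liminf (fun k => ‖f x‖ₑ ^ q k) atTop ∂μ :=
        lintegral_congr fun x => (hpow _).liminf_eq.symm
    _ ≤ liminf (fun k => ∫⁻ x, ‖f x‖ₑ ^ q k ∂μ) atTop :=
        lintegral_liminf_le' fun k => hf.enorm.pow_const _
    _ ≤ liminf (fun k => a k ^ q k) atTop := liminf_le_liminf (.of_forall hle)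
    _ = b ^ p := hapow.liminf_eq

/-! ### Test functions and Poincaré's inequality -/

/-- The Euclidean space `ℝᴺ`. -/
abbrev Euc (N : ℕ) : Type := EuclideanSpace ℝ (Fin N)

/-- The Lebesgue measure on the open set `Ω`. -/
abbrev volOn {N : ℕ} (Ω : TopologicalSpace.Opens (Euc N)) : Measure (Euc N) :=
  volume.restrict (Ω : Set (Euc N))

namespace TestFunction

variable {N : ℕ} {Ω : TopologicalSpace.Opens (Euc N)}

theorem differentiable (φ : TestFunction Ω ℝ (⊤ : ℕ∞)) : Differentiable ℝ (fun y => φ y) :=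
  φ.contDiff.differentiable (by simp)

theorem continuous_fderiv (φ : TestFunction Ω ℝ (⊤ : ℕ∞)) :
    Continuous (fderiv ℝ (fun y => φ y)) :=
  φ.contDiff.continuous_fderiv (by simp)

theorem continuous_gradient (φ : TestFunction Ω ℝ (⊤ : ℕ∞)) :
    Continuous (gradient (fun y => φ y)) :=
  (InnerProductSpace.toDual ℝ (Euc N)).symm.continuous.comp φ.continuous_fderiv

theorem hasCompactSupport_gradient (φ : TestFunction Ω ℝ (⊤ : ℕ∞)) :
    HasCompactSupport (gradient (fun y => φ y)) := by
  have h : HasCompactSupport (fderiv ℝ (fun y => φ y)) := φ.hasCompactSupport.fderiv ℝ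
  exact h.comp_left (g := (InnerProductSpace.toDual ℝ (Euc N)).symm) (map_zero _)

theorem support_gradient_subset (φ : TestFunction Ω ℝ (⊤ : ℕ∞)) :
    Function.support (gradient (fun y => φ y)) ⊆ Ω := by
  intro x hx
  refine φ.tsupport_subset (support_fderiv_subset ℝ (f := fun y => φ y) ?_)
  intro h
  exact hx (by simp [gradient, h])

theorem apply_eq_zero (φ : TestFunction Ω ℝ (⊤ : ℕ∞)) {x : Euc N} (hx : x ∉ Ω) : φ x = 0 :=
  image_eq_zero_of_notMem_tsupport fun h => hx (φ.tsupport_subset h)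

theorem norm_gradient (φ : TestFunction Ω ℝ (⊤ : ℕ∞)) (x : Euc N) :
    ‖gradient (fun y => φ y) x‖ = ‖fderiv ℝ (fun y => φ y) x‖ :=
  (InnerProductSpace.toDual ℝ (Euc N)).symm.norm_map _

theorem gradient_add (φ ψ : TestFunction Ω ℝ (⊤ : ℕ∞)) (x : Euc N) :
    gradient (fun y => (φ + ψ) y) x = gradient (fun y => φ y) x + gradient (fun y => ψ y) x := by
  have : (fun y => (φ + ψ) y) = (fun y => φ y) + fun y => ψ y := rfl
  simp only [gradient]
  rw [this, fderiv_add φ.differentiable.differentiableAt ψ.differentiable.differentiableAt, map_add]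

theorem gradient_smul (c : ℝ) (φ : TestFunction Ω ℝ (⊤ : ℕ∞)) (x : Euc N) :
    gradient (fun y => (c • φ) y) x = c • gradient (fun y => φ y) x := by
  have : (fun y => (c • φ) y) = c • fun y => φ y := rfl
  simp only [gradient]
  rw [this, fderiv_const_smul φ.differentiable.differentiableAt]
  simp

theorem memLp (φ : TestFunction Ω ℝ (⊤ : ℕ∞)) (p : ℝ≥0∞) : MemLp (fun x => φ x) p (volOn Ω) :=
  (φ.continuous.memLp_of_hasCompactSupport φ.hasCompactSupport).restrict _

theorem memLp_gradient (φ : TestFunction Ω ℝ (⊤ : ℕ∞)) (p : ℝ≥0∞) :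
    MemLp (gradient (fun y => φ y)) p (volOn Ω) :=
  (φ.continuous_gradient.memLp_of_hasCompactSupport φ.hasCompactSupport_gradient).restrict _

theorem exists_norm_le (φ : TestFunction Ω ℝ (⊤ : ℕ∞)) : ∃ C, ∀ x, ‖φ x‖ ≤ C :=
  φ.continuous.bounded_above_of_compact_support φ.hasCompactSupport

theorem exists_norm_gradient_le (φ : TestFunction Ω ℝ (⊤ : ℕ∞)) :
    ∃ C, ∀ x, ‖gradient (fun y => φ y) x‖ ≤ C :=
  φ.continuous_gradient.bounded_above_of_compact_support φ.hasCompactSupport_gradient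

theorem integral_smul_gradient (φ ψ : TestFunction Ω ℝ (⊤ : ℕ∞)) :
    ∫ x in (Ω : Set (Euc N)), φ x • gradient (fun y => ψ y) x =
      - ∫ x in (Ω : Set (Euc N)), ψ x • gradient (fun y => φ y) x := by
  have hint : ∀ φ ψ : TestFunction Ω ℝ (⊤ : ℕ∞),
      Integrable (fun x => φ x • gradient (fun y => ψ y) x) volume := fun φ ψ =>
    (φ.continuous.smul ψ.continuous_gradient).integrable_of_hasCompactSupport
      φ.hasCompactSupport.smul_right
  have hset : ∀ φ ψ : TestFunction Ω ℝ (⊤ : ℕ∞),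
      ∫ x in (Ω : Set (Euc N)), φ x • gradient (fun y => ψ y) x =
        ∫ x, φ x • gradient (fun y => ψ y) x := fun φ ψ =>
    setIntegral_eq_integral_of_forall_compl_eq_zero fun x hx => by
      rw [φ.apply_eq_zero hx, zero_smul]
  rw [hset, hset]
  refine ext_inner_left ℝ fun v => ?_
  rw [inner_neg_right, ← integral_inner (hint φ ψ), ← integral_inner (hint ψ φ)]
  have hinner : ∀ (φ : TestFunction Ω ℝ (⊤ : ℕ∞)) x,
      inner ℝ v (gradient (fun y => φ y) x) = fderiv ℝ (fun y => φ y) x v := fun φ x => by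
    rw [inner_gradient_right]; simp
  have hc : ∀ φ ψ : TestFunction Ω ℝ (⊤ : ℕ∞),
      Integrable (fun x => φ x * fderiv ℝ (fun y => ψ y) x v) volume := fun φ ψ =>
    (φ.continuous.mul (ψ.continuous_fderiv.clm_apply continuous_const)).integrable_of_hasCompactSupport
      φ.hasCompactSupport.mul_right
  simp only [inner_smul_right, hinner]
  have := integral_mul_fderiv_eq_neg_fderiv_mul_of_integrable (μ := volume) (f := fun x => φ x)
    (g := fun x => ψ x) (v := v) ?_ (hc φ ψ) ?_ (fun x _ => φ.differentiable x)
    (fun x _ => ψ.differentiable x)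
  · rw [this]
    simp only [mul_comm]
  · simpa only [mul_comm] using hc ψ φ
  · exact (φ.continuous.mul ψ.continuous).integrable_of_hasCompactSupport
      φ.hasCompactSupport.mul_right

/-- Moving from a point of Ω by the distance R in a unit direction leaves Ω, where φ vanishes; the
fundamental theorem of calculus along this segment gives the bound. -/
theorem enorm_le_lintegral_gradient (φ : TestFunction Ω ℝ (⊤ : ℕ∞)) {R : ℝ} (hR : 0 < R)
    (hdist : ∀ x ∈ Ω, ∀ y ∈ Ω, dist x y < R) {e : Euc N} (he : ‖e‖ = 1) (x : Euc N) :
    ‖φ x‖ₑ ≤ ∫⁻ τ in Set.Ioc 0 R, ‖gradient (fun y => φ y) (x + τ • e)‖ₑ := by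
  by_cases hx : x ∈ Ω
  swap
  · rw [φ.apply_eq_zero hx]; simp
  have hend : φ (x + R • e) = 0 := by
    refine φ.apply_eq_zero fun h => ?_
    have := hdist _ h x hx
    rw [dist_eq_norm, add_sub_cancel_left, norm_smul, he, Real.norm_of_nonneg hR.le] at this
    linarith
  have hderiv : ∀ τ : ℝ, HasDerivAt (fun τ : ℝ => φ (x + τ • e))
      (fderiv ℝ (fun y => φ y) (x + τ • e) e) τ := by
    intro τ
    have h1 : HasDerivAt (fun τ : ℝ => x + τ • e) e τ := by
      simpa using ((hasDerivAt_id τ).smul_const e).const_add x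
    exact (φ.differentiable (x + τ • e)).hasFDerivAt.comp_hasDerivAt τ h1
  have hcont : Continuous fun τ : ℝ => fderiv ℝ (fun y => φ y) (x + τ • e) e :=
    (φ.continuous_fderiv.comp (by fun_prop : Continuous fun τ : ℝ => x + τ • e)).clm_apply
      continuous_const
  have hftc := intervalIntegral.integral_eq_sub_of_hasDerivAt (a := 0) (b := R)
    (fun τ _ => hderiv τ) (hcont.intervalIntegrable _ _)
  rw [hend, zero_smul, add_zero, zero_sub, intervalIntegral.integral_of_le hR.le] at hftc
  rw [← enorm_neg, ← hftc]
  refine (enorm_integral_le_lintegral_enorm _).trans (lintegral_mono fun τ => ?_)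
  rw [enorm_le_iff_norm_le, φ.norm_gradient]
  simpa [he] using (fderiv ℝ (fun y => φ y) (x + τ • e)).le_opNorm e

/-- Poincaré's inequality for test functions, with a constant independent of the exponent. -/
theorem eLpNorm_le_mul_eLpNorm_gradient (hN : N ≠ 0) (φ : TestFunction Ω ℝ (⊤ : ℕ∞)) {R : ℝ}
    (hR : 0 < R) (hdist : ∀ x ∈ Ω, ∀ y ∈ Ω, dist x y < R) {s : ℝ} (hs : 1 ≤ s) :
    eLpNorm (fun x => φ x) (ENNReal.ofReal s) (volOn Ω) ≤
      ENNReal.ofReal R * eLpNorm (gradient (fun y => φ y)) (ENNReal.ofReal s) (volOn Ω) := by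
  have hs0 : 0 < s := by linarith
  have : Nonempty (Fin N) := ⟨⟨0, Nat.pos_of_ne_zero hN⟩⟩
  obtain ⟨e, he⟩ := exists_norm_eq (Euc N) (zero_le_one (α := ℝ))
  have hmeas : Measurable fun z : Euc N × ℝ => ‖gradient (fun y => φ y) (z.1 + z.2 • e)‖ₑ ^ s :=
    ((φ.continuous_gradient.comp
      (by fun_prop : Continuous fun z : Euc N × ℝ => z.1 + z.2 • e)).measurable.enorm).pow_const _
  -- Hölder's inequality in τ on an interval of length R produces R^(s - 1). Tonelli and translation
  -- invariance then contribute one more factor R, so the s-th root leaves exactly R.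
  have hpt : ∀ x, ‖φ x‖ₑ ^ s ≤ ENNReal.ofReal R ^ (s - 1) *
      ∫⁻ τ in Set.Ioc 0 R, ‖gradient (fun y => φ y) (x + τ • e)‖ₑ ^ s := by
    intro x
    have hm : AEStronglyMeasurable (fun τ : ℝ => gradient (fun y => φ y) (x + τ • e))
        (volume.restrict (Set.Ioc 0 R)) :=
      (φ.continuous_gradient.comp
        (by fun_prop : Continuous fun τ : ℝ => x + τ • e)).aestronglyMeasurable
    have h := eLpNorm_le_eLpNorm_mul_rpow_measure_univ (ENNReal.one_le_ofReal.2 hs) hm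
    rw [eLpNorm_one_eq_lintegral_enorm, Measure.restrict_apply_univ, Real.volume_Ioc, sub_zero,
      eLpNorm_eq_lintegral_rpow_enorm_toReal (by simpa using hs0) ENNReal.ofReal_ne_top,
      ENNReal.toReal_ofReal hs0.le] at h
    calc ‖φ x‖ₑ ^ s ≤ _ ^ s :=
          ENNReal.rpow_le_rpow ((φ.enorm_le_lintegral_gradient hR hdist he x).trans h) hs0.le
      _ = _ := by
          rw [ENNReal.mul_rpow_of_nonneg _ _ hs0.le, ← ENNReal.rpow_mul, ← ENNReal.rpow_mul,
            one_div_mul_cancel hs0.ne', ENNReal.rpow_one, mul_comm]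
          congr 2
          simp only [ENNReal.toReal_one]
          field_simp
  have hint : ∫⁻ x, ‖φ x‖ₑ ^ s ≤ ENNReal.ofReal R ^ s * ∫⁻ x, ‖gradient (fun y => φ y) x‖ₑ ^ s := by
    calc ∫⁻ x, ‖φ x‖ₑ ^ s ≤ ∫⁻ x, ENNReal.ofReal R ^ (s - 1) *
          ∫⁻ τ in Set.Ioc 0 R, ‖gradient (fun y => φ y) (x + τ • e)‖ₑ ^ s := lintegral_mono hpt
      _ = ENNReal.ofReal R ^ (s - 1) *
          ∫⁻ τ in Set.Ioc 0 R, ∫⁻ x, ‖gradient (fun y => φ y) (x + τ • e)‖ₑ ^ s := by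
          rw [lintegral_const_mul _ hmeas.lintegral_prod_right',
            lintegral_lintegral_swap hmeas.aemeasurable]
      _ = ENNReal.ofReal R ^ (s - 1) *
          (ENNReal.ofReal R * ∫⁻ x, ‖gradient (fun y => φ y) x‖ₑ ^ s) := by
          congr 1
          rw [lintegral_congr fun τ : ℝ => lintegral_add_right_eq_self
            (fun x => ‖gradient (fun y => φ y) x‖ₑ ^ s) (τ • e), setLIntegral_const,
            Real.volume_Ioc, sub_zero, mul_comm]
      _ = _ := by
          rw [← mul_assoc]
          congr 1
          nth_rw 2 [← ENNReal.rpow_one (ENNReal.ofReal R)]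
          rw [← ENNReal.rpow_add _ _ (by simpa using hR) ENNReal.ofReal_ne_top, sub_add_cancel]
  refine (eLpNorm_mono_measure _ Measure.restrict_le_self).trans ?_
  rw [eLpNorm_restrict_eq_of_support_subset φ.support_gradient_subset,
    eLpNorm_eq_lintegral_rpow_enorm_toReal (by simpa using hs0) ENNReal.ofReal_ne_top,
    eLpNorm_eq_lintegral_rpow_enorm_toReal (by simpa using hs0) ENNReal.ofReal_ne_top,
    ENNReal.toReal_ofReal hs0.le]
  calc _ ≤ (ENNReal.ofReal R ^ s * ∫⁻ x, ‖gradient (fun y => φ y) x‖ₑ ^ s) ^ (1 / s) :=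
        ENNReal.rpow_le_rpow hint (by positivity)
    _ = _ := by
        rw [ENNReal.mul_rpow_of_nonneg _ _ (by positivity), ← ENNReal.rpow_mul,
          mul_one_div_cancel hs0.ne', ENNReal.rpow_one]

end TestFunction

theorem isFiniteMeasure_volOn {N : ℕ} {Ω : TopologicalSpace.Opens (Euc N)}
    (hΩ : Bornology.IsBounded (Ω : Set (Euc N))) : IsFiniteMeasure (volOn Ω) :=
  ⟨by rw [Measure.restrict_apply_univ]; exact hΩ.measure_lt_top⟩

/-! ### Pairs approximated by test functions and their gradients -/

/-- The pair `(f, G)` is the limit in `L^p(Ω)` of test functions and of their gradients. -/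
def SobolevLimit {N : ℕ} (Ω : TopologicalSpace.Opens (Euc N)) (p : ℝ) (f : Euc N → ℝ)
    (G : Euc N → Euc N) : Prop :=
  MemLp f (ENNReal.ofReal p) (volOn Ω) ∧ MemLp G (ENNReal.ofReal p) (volOn Ω) ∧
    ∀ ε : ℝ≥0∞, 0 < ε → ∃ φ : TestFunction Ω ℝ (⊤ : ℕ∞),
      eLpNorm (fun x => f x - φ x) (ENNReal.ofReal p) (volOn Ω) < ε ∧
      eLpNorm (fun x => G x - gradient (fun y => φ y) x) (ENNReal.ofReal p) (volOn Ω) < ε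

namespace SobolevLimit

variable {N : ℕ} {Ω : TopologicalSpace.Opens (Euc N)} {p : ℝ} {f f' : Euc N → ℝ}
  {G G' : Euc N → Euc N}

theorem congr (h : SobolevLimit Ω p f G) (hf : f =ᵐ[volOn Ω] f') (hG : G =ᵐ[volOn Ω] G') :
    SobolevLimit Ω p f' G' := by
  refine ⟨h.1.ae_eq hf, h.2.1.ae_eq hG, fun ε hε => ?_⟩
  obtain ⟨φ, h1, h2⟩ := h.2.2 ε hε
  refine ⟨φ, ?_, ?_⟩
  · exact (eLpNorm_congr_ae (hf.sub (ae_eq_refl fun x => φ x))).symm.trans_lt h1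
  · exact (eLpNorm_congr_ae (hG.sub (ae_eq_refl (gradient fun y => φ y)))).symm.trans_lt h2

theorem add (hp : 1 ≤ p) (h : SobolevLimit Ω p f G) (h' : SobolevLimit Ω p f' G') :
    SobolevLimit Ω p (f + f') (G + G') := by
  refine ⟨h.1.add h'.1, h.2.1.add h'.2.1, fun ε hε => ?_⟩
  have hε2 : 0 < ε / 2 := ENNReal.half_pos hε.ne'
  have hp1 : 1 ≤ ENNReal.ofReal p := ENNReal.one_le_ofReal.2 hp
  obtain ⟨φ, h1, h2⟩ := h.2.2 _ hε2
  obtain ⟨ψ, h3, h4⟩ := h'.2.2 _ hε2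
  refine ⟨φ + ψ, ?_, ?_⟩
  · have : (fun x => (f + f') x - (φ + ψ) x) = (fun x => f x - φ x) + fun x => f' x - ψ x := by
      ext x
      change f x + f' x - (φ x + ψ x) = f x - φ x + (f' x - ψ x)
      ring
    rw [this, ← ENNReal.add_halves ε]
    exact (eLpNorm_add_le (h.1.sub (φ.memLp _)).1 (h'.1.sub (ψ.memLp _)).1 hp1).trans_lt
      (ENNReal.add_lt_add h1 h3)
  · have : (fun x => (G + G') x - gradient (fun y => (φ + ψ) y) x) =
        (fun x => G x - gradient (fun y => φ y) x) + fun x => G' x - gradient (fun y => ψ y) x := by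
      ext1 x
      rw [TestFunction.gradient_add]
      simp only [Pi.add_apply]
      abel
    rw [this, ← ENNReal.add_halves ε]
    exact (eLpNorm_add_le (h.2.1.sub (φ.memLp_gradient _)).1 (h'.2.1.sub (ψ.memLp_gradient _)).1
      hp1).trans_lt (ENNReal.add_lt_add h2 h4)

theorem smul (c : ℝ) (h : SobolevLimit Ω p f G) : SobolevLimit Ω p (c • f) (c • G) := by
  refine ⟨h.1.const_smul c, h.2.1.const_smul c, fun ε hε => ?_⟩
  obtain ⟨δ, hδ, hδε⟩ : ∃ δ : ℝ≥0∞, 0 < δ ∧ ‖c‖ₑ * δ < ε := by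
    have : Tendsto (fun δ : ℝ≥0∞ => ‖c‖ₑ * δ) (𝓝[>] 0) (𝓝 0) := by
      have := (ENNReal.continuous_const_mul (enorm_ne_top (x := c))).tendsto 0
      rw [mul_zero] at this
      exact this.mono_left nhdsWithin_le_nhds
    obtain ⟨δ, h1, h2⟩ := ((this.eventually_lt_const hε).and self_mem_nhdsWithin).exists
    exact ⟨δ, h2, h1⟩
  obtain ⟨φ, h1, h2⟩ := h.2.2 δ hδ
  refine ⟨c • φ, ?_, ?_⟩
  · have : (fun x => (c • f) x - (c • φ) x) = c • fun x => f x - φ x := by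
      ext x
      change c * f x - c * φ x = c * (f x - φ x)
      ring
    rw [this]
    refine (eLpNorm_const_smul_le).trans_lt (lt_of_le_of_lt ?_ hδε)
    gcongr
  · have : (fun x => (c • G) x - gradient (fun y => (c • φ) y) x) =
        c • fun x => G x - gradient (fun y => φ y) x := by
      ext1 x
      rw [TestFunction.gradient_smul]
      simp only [Pi.smul_apply, smul_sub]
    rw [this]
    refine (eLpNorm_const_smul_le).trans_lt (lt_of_le_of_lt ?_ hδε)
    gcongr

theorem sub (hp : 1 ≤ p) (h : SobolevLimit Ω p f G) (h' : SobolevLimit Ω p f' G') :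
    SobolevLimit Ω p (f - f') (G - G') := by
  have := h.add hp (h'.smul (-1))
  simpa [sub_eq_add_neg] using this

theorem mono (hΩ : Bornology.IsBounded (Ω : Set (Euc N))) {q : ℝ} (hq : 0 < q) (hqp : q ≤ p)
    (h : SobolevLimit Ω p f G) : SobolevLimit Ω q f G := by
  have := isFiniteMeasure_volOn hΩ
  have hle : ENNReal.ofReal q ≤ ENNReal.ofReal p := ENNReal.ofReal_le_ofReal hqp
  refine ⟨h.1.mono_exponent hle, h.2.1.mono_exponent hle, fun ε hε => ?_⟩
  set c := volOn Ω Set.univ ^ (1 / (ENNReal.ofReal q).toReal - 1 / (ENNReal.ofReal p).toReal)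
  have hc : c ≠ ⊤ := by
    refine ENNReal.rpow_ne_top_of_nonneg ?_ (measure_ne_top _ _)
    rw [ENNReal.toReal_ofReal hq.le, ENNReal.toReal_ofReal (hq.le.trans hqp), sub_nonneg]
    exact one_div_le_one_div_of_le hq hqp
  obtain ⟨δ, hδ, hδε⟩ : ∃ δ : ℝ≥0∞, 0 < δ ∧ δ * c < ε := by
    have : Tendsto (fun δ : ℝ≥0∞ => δ * c) (𝓝[>] 0) (𝓝 0) := by
      have := (ENNReal.continuous_mul_const hc).tendsto 0
      rw [zero_mul] at this
      exact this.mono_left nhdsWithin_le_nhds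
    obtain ⟨δ, h1, h2⟩ := ((this.eventually_lt_const hε).and self_mem_nhdsWithin).exists
    exact ⟨δ, h2, h1⟩
  obtain ⟨φ, h1, h2⟩ := h.2.2 δ hδ
  refine ⟨φ, ?_, ?_⟩
  · refine (eLpNorm_le_eLpNorm_mul_rpow_measure_univ hle (h.1.sub (φ.memLp _)).1).trans_lt
      (lt_of_le_of_lt ?_ hδε)
    gcongr
    exact h1.le
  · refine (eLpNorm_le_eLpNorm_mul_rpow_measure_univ hle
      (h.2.1.sub (φ.memLp_gradient _)).1).trans_lt (lt_of_le_of_lt ?_ hδε)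
    gcongr
    exact h2.le

theorem of_tendsto (hp : 1 ≤ p) {u : ℕ → Euc N → ℝ} {V : ℕ → Euc N → Euc N}
    (h : ∀ n, SobolevLimit Ω p (u n) (V n)) (hf : MemLp f (ENNReal.ofReal p) (volOn Ω))
    (hG : MemLp G (ENNReal.ofReal p) (volOn Ω))
    (huf : Tendsto (fun n => eLpNorm (u n - f) (ENNReal.ofReal p) (volOn Ω)) atTop (𝓝 0))
    (hVG : Tendsto (fun n => eLpNorm (V n - G) (ENNReal.ofReal p) (volOn Ω)) atTop (𝓝 0)) :
    SobolevLimit Ω p f G := by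
  refine ⟨hf, hG, fun ε hε => ?_⟩
  have hε2 : 0 < ε / 2 := ENNReal.half_pos hε.ne'
  have hp1 : 1 ≤ ENNReal.ofReal p := ENNReal.one_le_ofReal.2 hp
  obtain ⟨n, h1, h2⟩ := ((huf.eventually_lt_const hε2).and (hVG.eventually_lt_const hε2)).exists
  obtain ⟨φ, h3, h4⟩ := (h n).2.2 _ hε2
  rw [eLpNorm_sub_comm] at h1 h2
  refine ⟨φ, ?_, ?_⟩
  · have : (fun x => f x - φ x) = (f - u n) + fun x => u n x - φ x := by
      ext x; simp
    rw [this, ← ENNReal.add_halves ε]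
    exact (eLpNorm_add_le (hf.sub (h n).1).1 ((h n).1.sub (φ.memLp _)).1 hp1).trans_lt
      (ENNReal.add_lt_add h1 h3)
  · have : (fun x => G x - gradient (fun y => φ y) x) =
        (G - V n) + fun x => V n x - gradient (fun y => φ y) x := by
      ext1 x; simp
    rw [this, ← ENNReal.add_halves ε]
    exact (eLpNorm_add_le (hG.sub (h n).2.1).1 ((h n).2.1.sub (φ.memLp_gradient _)).1
      hp1).trans_lt (ENNReal.add_lt_add h2 h4)

theorem exists_tendsto (h : SobolevLimit Ω p f G) : ∃ φ : ℕ → TestFunction Ω ℝ (⊤ : ℕ∞),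
    Tendsto (fun n => eLpNorm (fun x => φ n x - f x) (ENNReal.ofReal p) (volOn Ω)) atTop (𝓝 0) ∧
    Tendsto (fun n => eLpNorm (fun x => gradient (fun y => φ n y) x - G x) (ENNReal.ofReal p)
      (volOn Ω)) atTop (𝓝 0) := by
  -- For n = 0 the tolerance is 0⁻¹ = ⊤ in `ℝ≥0∞`, still positive.
  have h0 : ∀ n : ℕ, (0 : ℝ≥0∞) < (n : ℝ≥0∞)⁻¹ := fun n =>
    ENNReal.inv_pos.2 (ENNReal.natCast_ne_top n)
  choose φ h1 h2 using fun n : ℕ => h.2.2 _ (h0 n)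
  refine ⟨φ, ?_, ?_⟩
  · refine tendsto_of_tendsto_of_tendsto_of_le_of_le tendsto_const_nhds
      ENNReal.tendsto_inv_nat_nhds_zero (fun _ => zero_le) fun n => ?_
    have := eLpNorm_sub_comm (fun x => φ n x) f (ENNReal.ofReal p) (volOn Ω)
    exact this.le.trans (h1 n).le
  · refine tendsto_of_tendsto_of_tendsto_of_le_of_le tendsto_const_nhds
      ENNReal.tendsto_inv_nat_nhds_zero (fun _ => zero_le) fun n => ?_
    have := eLpNorm_sub_comm (gradient fun y => φ n y) G (ENNReal.ofReal p) (volOn Ω)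
    exact this.le.trans (h2 n).le

end SobolevLimit

theorem tendsto_eLpNorm_of_tendsto_eLpNorm_sub {α F : Type*} [MeasurableSpace α] {μ : Measure α}
    [NormedAddCommGroup F] {p : ℝ≥0∞} (hp : 1 ≤ p) {u : ℕ → α → F} {f : α → F}
    (hu : ∀ n, MemLp (u n) p μ) (hf : MemLp f p μ)
    (h : Tendsto (fun n => eLpNorm (fun x => u n x - f x) p μ) atTop (𝓝 0)) :
    Tendsto (fun n => eLpNorm (u n) p μ) atTop (𝓝 (eLpNorm f p μ)) := by
  have : Fact (1 ≤ p) := ⟨hp⟩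
  have h1 := (Lp.tendsto_Lp_iff_tendsto_eLpNorm'' u hu f hf).2 h
  have h2 := (continuous_enorm.tendsto _).comp h1
  simpa [Function.comp_def, Lp.enorm_toLp] using h2

namespace SobolevLimit

variable {N : ℕ} {Ω : TopologicalSpace.Opens (Euc N)} {p : ℝ} {f f' : Euc N → ℝ}
  {G G' : Euc N → Euc N}

/-- Poincaré's inequality. -/
theorem eLpNorm_le (hN : N ≠ 0) (hp : 1 ≤ p) (h : SobolevLimit Ω p f G) {R : ℝ}
    (hR : 0 < R) (hdist : ∀ x ∈ Ω, ∀ y ∈ Ω, dist x y < R) :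
    eLpNorm f (ENNReal.ofReal p) (volOn Ω) ≤
      ENNReal.ofReal R * eLpNorm G (ENNReal.ofReal p) (volOn Ω) := by
  have hp1 : 1 ≤ ENNReal.ofReal p := ENNReal.one_le_ofReal.2 hp
  obtain ⟨φ, h1, h2⟩ := h.exists_tendsto
  have h3 := tendsto_eLpNorm_of_tendsto_eLpNorm_sub hp1 (fun n => (φ n).memLp _) h.1 h1
  have h4 := tendsto_eLpNorm_of_tendsto_eLpNorm_sub hp1 (fun n => (φ n).memLp_gradient _) h.2.1 h2
  exact le_of_tendsto_of_tendsto' h3 (ENNReal.Tendsto.const_mul h4 (Or.inr ENNReal.ofReal_ne_top))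
    fun n => (φ n).eLpNorm_le_mul_eLpNorm_gradient hN hR hdist hp

end SobolevLimit

/-! ### Weak gradients and the spaces W^{1,p}_0 -/

/-- Serves to pass to the limit in both sides of the integration by parts formula, where `U n` is `u
n` multiplied by a bounded test function or by its bounded gradient. -/
theorem tendsto_integral_of_norm_sub_le {α F F' : Type*} [MeasurableSpace α] {μ : Measure α}
    [IsFiniteMeasure μ] [NormedAddCommGroup F] [NormedAddCommGroup F'] [NormedSpace ℝ F']
    {p : ℝ≥0∞} (hp : 1 ≤ p) {u : ℕ → α → F} {f : α → F} {U : ℕ → α → F'} {g : α → F'}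
    (hu : ∀ n, MemLp (u n) p μ) (hf : MemLp f p μ)
    (h : Tendsto (fun n => eLpNorm (fun x => u n x - f x) p μ) atTop (𝓝 0))
    (hU : ∀ n, Integrable (U n) μ) (hg : Integrable g μ) (C : ℝ)
    (hle : ∀ n x, ‖U n x - g x‖ ≤ C * ‖u n x - f x‖) :
    Tendsto (fun n => ∫ x, U n x ∂μ) atTop (𝓝 (∫ x, g x ∂μ)) := by
  refine tendsto_integral_of_L1' g hg.1 (.of_forall hU) ?_
  set c := μ Set.univ ^ (1 / (1 : ℝ≥0∞).toReal - 1 / p.toReal) with hc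
  have hctop : c ≠ ⊤ := by
    refine ENNReal.rpow_ne_top_of_nonneg ?_ (measure_ne_top _ _)
    rw [sub_nonneg]
    rcases eq_or_ne p ⊤ with rfl | hptop
    · simp
    · exact one_div_le_one_div_of_le (by simp) (ENNReal.toReal_mono hptop hp)
  have hlim : Tendsto (fun n => ENNReal.ofReal C * (eLpNorm (fun x => u n x - f x) p μ * c)) atTop
      (𝓝 0) := by
    have := ENNReal.Tendsto.const_mul (a := ENNReal.ofReal C)
      (ENNReal.Tendsto.mul_const (b := c) h (Or.inr hctop)) (Or.inr ENNReal.ofReal_ne_top)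
    simpa using this
  refine tendsto_of_tendsto_of_tendsto_of_le_of_le tendsto_const_nhds hlim (fun _ => zero_le)
    fun n => ?_
  exact (eLpNorm_le_mul_eLpNorm_of_ae_le_mul (ae_of_all _ (hle n)) 1).trans
    (mul_le_mul_right (eLpNorm_le_eLpNorm_mul_rpow_measure_univ hp ((hu n).sub hf).1) _)

theorem TestFunction.integrable_smul {N : ℕ} {Ω : TopologicalSpace.Opens (Euc N)} {F : Type*}
    [NormedAddCommGroup F] [NormedSpace ℝ F] (φ : TestFunction Ω ℝ (⊤ : ℕ∞)) {G : Euc N → F}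
    (hG : LocallyIntegrableOn G (Ω : Set (Euc N)) volume) :
    Integrable (fun x => φ x • G x) volume := by
  have h1 : IntegrableOn G (tsupport φ) volume :=
    hG.integrableOn_compact_subset φ.tsupport_subset φ.hasCompactSupport
  have h2 : IntegrableOn (fun x => φ x • G x) (tsupport φ) volume :=
    h1.continuousOn_smul φ.continuous.continuousOn φ.hasCompactSupport
  refine (integrableOn_iff_integrable_of_support_subset ?_).1 h2
  exact (Function.support_smul_subset_left _ _).trans (subset_tsupport _)

/-- The weak gradient is unique. -/
theorem HasWeakGradient.ae_eq {N : ℕ} {Ω : TopologicalSpace.Opens (Euc N)} {u : L1loc Ω}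
    {G G' : Euc N → Euc N} (h : HasWeakGradient u G) (h' : HasWeakGradient u G') :
    G =ᵐ[volOn Ω] G' := by
  have hae : ∀ᵐ x ∂(volume : Measure (Euc N)), x ∈ (Ω : Set (Euc N)) → (G - G') x = 0 := by
    refine Ω.isOpen.ae_eq_zero_of_integral_contDiff_smul_eq_zero (h.1.sub h'.1)
      fun g hg hgc hgs => ?_
    set φ : TestFunction Ω ℝ (⊤ : ℕ∞) := ⟨g, hg, hgc, hgs⟩
    have hset : ∀ H : Euc N → Euc N, ∫ x in (Ω : Set (Euc N)), φ x • H x = ∫ x, φ x • H x :=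
      fun H => setIntegral_eq_integral_of_forall_compl_eq_zero fun x hx => by
        rw [φ.apply_eq_zero hx, zero_smul]
    have h1 := (h.2 φ).symm.trans (h'.2 φ)
    rw [neg_inj, hset, hset] at h1
    change ∫ x, φ x • (G - G') x = 0
    simp only [Pi.sub_apply, smul_sub]
    rw [integral_sub (φ.integrable_smul h.1) (φ.integrable_smul h'.1), h1, sub_self]
  rw [Filter.EventuallyEq, ae_restrict_iff' Ω.isOpen.measurableSet]
  filter_upwards [hae] with x hx hxΩ
  exact sub_eq_zero.1 (hx hxΩ)

theorem HasWeakGradient.weakGradient {N : ℕ} {Ω : TopologicalSpace.Opens (Euc N)} {u : L1loc Ω}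
    {G : Euc N → Euc N} (h : HasWeakGradient u G) : HasWeakGradient u (weakGradient u) := by
  have hex : ∃ G, HasWeakGradient u G := ⟨G, h⟩
  rw [_root_.weakGradient, dif_pos hex]
  exact hex.choose_spec

/-- Test functions satisfy the integration by parts formula, and both of its sides are continuous
under L^p convergence on a set of finite measure. -/
theorem SobolevLimit.hasWeakGradient {N : ℕ} {Ω : TopologicalSpace.Opens (Euc N)}
    (hΩ : Bornology.IsBounded (Ω : Set (Euc N))) {p : ℝ} (hp : 1 ≤ p) {u : L1loc Ω}
    {G : Euc N → Euc N} (h : SobolevLimit Ω p (fun x => u x) G) : HasWeakGradient u G := by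
  have := isFiniteMeasure_volOn hΩ
  have hp1 : 1 ≤ ENNReal.ofReal p := ENNReal.one_le_ofReal.2 hp
  have hGint : IntegrableOn G (Ω : Set (Euc N)) volume := h.2.1.integrable hp1
  refine ⟨hGint.locallyIntegrableOn, fun ψ => ?_⟩
  obtain ⟨φ, h1, h2⟩ := h.exists_tendsto
  obtain ⟨C₁, hC₁⟩ := ψ.exists_norm_gradient_le
  obtain ⟨C₂, hC₂⟩ := ψ.exists_norm_le
  have hI₁ : ∀ f : Euc N → ℝ, Integrable f (volOn Ω) →
      Integrable (fun x => f x • gradient (fun y => ψ y) x) (volOn Ω) := fun f hf =>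
    hf.smul_bdd C₁ ψ.continuous_gradient.aestronglyMeasurable (ae_of_all _ hC₁)
  have hI₂ : ∀ H : Euc N → Euc N, Integrable H (volOn Ω) →
      Integrable (fun x => ψ x • H x) (volOn Ω) := fun H hH =>
    hH.bdd_smul C₂ ψ.continuous.aestronglyMeasurable (ae_of_all _ hC₂)
  have hlim₁ := tendsto_integral_of_norm_sub_le hp1 (fun n => (φ n).memLp _) h.1 h1
    (fun n => hI₁ _ (((φ n).memLp _).integrable hp1)) (hI₁ _ (h.1.integrable hp1)) C₁
    fun n x => by
      rw [← sub_smul, norm_smul, mul_comm]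
      gcongr
      exact hC₁ x
  have hlim₂ := tendsto_integral_of_norm_sub_le hp1 (fun n => (φ n).memLp_gradient _) h.2.1 h2
    (fun n => hI₂ _ (((φ n).memLp_gradient _).integrable hp1)) (hI₂ _ hGint) C₂
    fun n x => by
      rw [← smul_sub, norm_smul]
      gcongr
      exact hC₂ x
  simp only [TestFunction.integral_smul_gradient _ ψ] at hlim₁
  exact tendsto_nhds_unique hlim₁ hlim₂.neg

/-- Replaces membership by a condition on a pair of plain functions, which can be added, scaled and
passed to the limit without mentioning weak derivatives. -/
theorem mem_W10_iff {N : ℕ} {Ω : TopologicalSpace.Opens (Euc N)} {p : ℝ} {u : L1loc Ω}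
    (hΩ : Bornology.IsBounded (Ω : Set (Euc N))) (hp : 1 ≤ p) :
    u ∈ W10 Ω p ↔ SobolevLimit Ω p (fun x => u x) (weakGradient u) := by
  constructor
  · rintro ⟨⟨h1, G, hG, hGp⟩, h2⟩
    exact ⟨h1, hGp.ae_eq (hG.ae_eq hG.weakGradient), h2⟩
  · intro h
    exact ⟨⟨h.1, _, h.hasWeakGradient hΩ hp, h.2.1⟩, h.2.2⟩

theorem SobolevLimit.weakGradient_ae_eq {N : ℕ} {Ω : TopologicalSpace.Opens (Euc N)}
    (hΩ : Bornology.IsBounded (Ω : Set (Euc N))) {p : ℝ} (hp : 1 ≤ p) {u : L1loc Ω}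
    {G : Euc N → Euc N} (h : SobolevLimit Ω p (fun x => u x) G) :
    G =ᵐ[volOn Ω] weakGradient u :=
  (h.hasWeakGradient hΩ hp).ae_eq (h.hasWeakGradient hΩ hp).weakGradient

theorem W10_subset_W10 {N : ℕ} {Ω : TopologicalSpace.Opens (Euc N)}
    (hΩ : Bornology.IsBounded (Ω : Set (Euc N))) {s p : ℝ} (hs : 1 ≤ s) (hsp : s ≤ p) :
    W10 Ω p ⊆ W10 Ω s := by
  intro u hu
  rw [mem_W10_iff hΩ (hs.trans hsp)] at hu
  rw [mem_W10_iff hΩ hs]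
  exact hu.mono hΩ (by linarith) hsp

theorem W10_subset_W10minus {N : ℕ} {Ω : TopologicalSpace.Opens (Euc N)}
    (hΩ : Bornology.IsBounded (Ω : Set (Euc N))) {p : ℝ} :
    W10 Ω p ⊆ W10minus Ω p := fun _ hu =>
  ⟨hu.1, Set.mem_iInter₂.2 fun _ hs => W10_subset_W10 hΩ hs.1.le hs.2.le hu⟩

theorem W10minus_subset_W10 {N : ℕ} {Ω : TopologicalSpace.Opens (Euc N)} {s p : ℝ}
    (hs : 1 < s) (hsp : s < p) : W10minus Ω p ⊆ W10 Ω s := fun _ hu =>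
  Set.mem_iInter₂.1 hu.2 s ⟨hs, hsp⟩

theorem dirichletEnergyOn_of_mem {N : ℕ} {Ω : TopologicalSpace.Opens (Euc N)}
    {W : Set (L1loc Ω)} {p : ℝ} (hp : 0 < p) {u : L1loc Ω} (hu : u ∈ W) :
    dirichletEnergyOn W p u = eLpNorm (weakGradient u) (ENNReal.ofReal p) (volOn Ω) := by
  rw [dirichletEnergyOn, if_pos hu, eLpNorm_eq_lintegral_rpow_enorm_toReal (by simpa using hp)
    ENNReal.ofReal_ne_top, ENNReal.toReal_ofReal hp.le]

theorem mem_of_dirichletEnergyOn_lt_top {N : ℕ} {Ω : TopologicalSpace.Opens (Euc N)}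
    {W : Set (L1loc Ω)} {p : ℝ} {u : L1loc Ω} (h : dirichletEnergyOn W p u < ⊤) : u ∈ W := by
  by_contra hu
  rw [dirichletEnergyOn, if_neg hu] at h
  exact lt_irrefl _ h

theorem energyMinus_le_energy {N : ℕ} {Ω : TopologicalSpace.Opens (Euc N)}
    (hΩ : Bornology.IsBounded (Ω : Set (Euc N))) {p : ℝ} (hp : 0 < p) (u : L1loc Ω) :
    energyMinus Ω p u ≤ energy Ω p u := by
  by_cases hu : u ∈ W10 Ω p
  · rw [energy, energyMinus, dirichletEnergyOn_of_mem hp hu,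
      dirichletEnergyOn_of_mem hp (W10_subset_W10minus hΩ hu)]
  · rw [energy, dirichletEnergyOn, if_neg hu]
    exact le_top

/-! ### Convex combinations and membership of the limit -/

theorem L1loc.tendsto_eLpNorm {N : ℕ} {Ω : TopologicalSpace.Opens (Euc N)} {v : ℕ → L1loc Ω}
    {u : L1loc Ω} (h : Tendsto v atTop (𝓝 u)) {K : Set (Euc N)} (hK : IsCompact K)
    (hKΩ : K ⊆ Ω) :
    Tendsto (fun n => eLpNorm ((fun x => v n x) - fun x => u x) 1 (volume.restrict K)) atTop
      (𝓝 0) := by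
  rw [nhds_iInf, tendsto_iInf] at h
  have h := h ⟨K, hK, hKΩ⟩
  rw [nhds_induced, tendsto_comap_iff, Lp.tendsto_Lp_iff_tendsto_eLpNorm'] at h
  refine h.congr fun n => eLpNorm_congr_ae ?_
  exact ((v n).integrable_restrict hK hKΩ).coeFn_toL1.sub
    (u.integrable_restrict hK hKΩ).coeFn_toL1

theorem TopologicalSpace.Opens.ae_eq_of_forall_isCompact {N : ℕ}
    {Ω : TopologicalSpace.Opens (Euc N)} {F : Type*} {f g : Euc N → F}
    (h : ∀ K : Set (Euc N), IsCompact K → K ⊆ Ω → f =ᵐ[volume.restrict K] g) :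
    f =ᵐ[volOn Ω] g := by
  have : LocallyCompactSpace (Ω : Set (Euc N)) := Ω.isOpen.locallyCompactSpace
  have : SigmaCompactSpace (Ω : Set (Euc N)) := inferInstance
  obtain ⟨K, hK, hKΩ⟩ := isSigmaCompact_iff_sigmaCompactSpace.2 this
  rw [volOn, ← hKΩ, Filter.EventuallyEq, ae_restrict_iUnion_iff]
  exact fun n => h _ (hK n) (hKΩ ▸ Set.subset_iUnion K n)

theorem eLpNorm_convex_combination_le {α F : Type*} [MeasurableSpace α] {μ : Measure α}
    [NormedAddCommGroup F] [NormedSpace ℝ F] {p : ℝ≥0∞} (hp : 1 ≤ p) {f g : α → F}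
    (hf : AEStronglyMeasurable f μ) (hg : AEStronglyMeasurable g μ) {B : ℝ≥0∞}
    (hfB : eLpNorm f p μ ≤ B) (hgB : eLpNorm g p μ ≤ B) {a b : ℝ} (ha : 0 ≤ a) (hb : 0 ≤ b)
    (hab : a + b = 1) : eLpNorm (a • f + b • g) p μ ≤ B :=
  calc eLpNorm (a • f + b • g) p μ ≤ eLpNorm (a • f) p μ + eLpNorm (b • g) p μ :=
        eLpNorm_add_le (hf.const_smul a) (hg.const_smul b) hp
    _ ≤ ENNReal.ofReal a * B + ENNReal.ofReal b * B := by
        rw [eLpNorm_const_smul, eLpNorm_const_smul, Real.enorm_of_nonneg ha,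
          Real.enorm_of_nonneg hb]
        gcongr
    _ = B := by rw [← add_mul, ← ENNReal.ofReal_add ha hb, hab, ENNReal.ofReal_one, one_mul]

theorem convex_setOf_sobolevLimit {N : ℕ} {Ω : TopologicalSpace.Opens (Euc N)} {s : ℝ}
    (hs : 1 ≤ s) (B : ℝ≥0∞) :
    Convex ℝ {z : (Euc N → ℝ) × (Euc N → Euc N) | SobolevLimit Ω s z.1 z.2 ∧
      eLpNorm z.2 (ENNReal.ofReal s) (volOn Ω) ≤ B} := by
  rintro x ⟨hx, hxB⟩ y ⟨hy, hyB⟩ a b ha hb hab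
  exact ⟨(hx.smul a).add hs (hy.smul b), eLpNorm_convex_combination_le
    (ENNReal.one_le_ofReal.2 hs) hx.2.1.1 hy.2.1.1 hxB hyB ha hb hab⟩

/-- Balls of L¹(K) around the limit are convex, so a tail contained in such a ball has its convex
hull contained in it. The second component is unrestricted, so that this applies to pairs of a
function and a gradient. -/
theorem convex_setOf_eLpNorm_sub_le {α F V : Type*} [MeasurableSpace α] {μ : Measure α}
    [NormedAddCommGroup F] [NormedSpace ℝ F] [AddCommGroup V] [Module ℝ V] {u : α → F}
    (hu : AEStronglyMeasurable u μ) (B : ℝ≥0∞) :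
    Convex ℝ {z : (α → F) × V | AEStronglyMeasurable z.1 μ ∧ eLpNorm (z.1 - u) 1 μ ≤ B} := by
  rintro x ⟨hx, hxB⟩ y ⟨hy, hyB⟩ a b ha hb hab
  refine ⟨(hx.const_smul a).add (hy.const_smul b), ?_⟩
  have : (a • x + b • y).1 - u = a • (x.1 - u) + b • (y.1 - u) := by
    obtain rfl : b = 1 - a := by linarith
    simp only [Prod.fst_add, Prod.smul_fst, smul_sub, sub_smul, one_smul, Prod.fst_sub]
    abel
  rw [this]
  exact eLpNorm_convex_combination_le le_rfl (hx.sub hu) (hy.sub hu) hxB hyB ha hb hab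

theorem integral_sqrt_one_add_norm_sq_le {α F : Type*} [MeasurableSpace α] {μ : Measure α}
    [IsFiniteMeasure μ] [NormedAddCommGroup F] {G : α → F} (hG : Integrable G μ) {B : ℝ≥0∞}
    (hB : B ≠ ⊤) (h : eLpNorm G 1 μ ≤ B) :
    ∫ x, √(1 + ‖G x‖ ^ 2) ∂μ ≤ μ.real Set.univ + B.toReal := by
  have h1 : ∫ x, ‖G x‖ ∂μ ≤ B.toReal := by
    rw [integral_norm_eq_lintegral_enorm hG.1, ← eLpNorm_one_eq_lintegral_enorm]
    exact ENNReal.toReal_mono hB h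
  calc ∫ x, √(1 + ‖G x‖ ^ 2) ∂μ ≤ ∫ x, (1 + ‖G x‖) ∂μ := by
        refine integral_mono hG.sqrt_one_add_norm_sq ((integrable_const 1).add hG.norm) fun x => ?_
        exact Real.sqrt_le_iff.2 ⟨by positivity, by nlinarith [norm_nonneg (G x)]⟩
    _ = μ.real Set.univ + ∫ x, ‖G x‖ ∂μ := by
        rw [integral_add (integrable_const 1) hG.norm]; simp
    _ ≤ _ := by gcongr

theorem exists_pos_forall_dist_lt {X : Type*} [PseudoMetricSpace X] {S : Set X}
    (hS : Bornology.IsBounded S) : ∃ R : ℝ, 0 < R ∧ ∀ x ∈ S, ∀ y ∈ S, dist x y < R := by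
  obtain ⟨C, hC⟩ := Metric.isBounded_iff.1 hS
  exact ⟨max C 0 + 1, by positivity, fun x hx y hy =>
    (hC hx hy).trans_lt ((le_max_left _ _).trans_lt (lt_add_one _))⟩

/-- Functions converging in `L¹_loc(Ω)`, with gradients bounded in `L^s(Ω)`, have convex combinations
with the same limit, along which the convexity defect of `∫ √(1 + ‖∇·‖ ^ 2)` tends to `0`. -/
theorem exists_convex_combinations {N : ℕ} {Ω : TopologicalSpace.Opens (Euc N)}
    (hΩ : Bornology.IsBounded (Ω : Set (Euc N))) {s : ℝ} (hs : 1 ≤ s) {v : ℕ → L1loc Ω}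
    {u : L1loc Ω} (hv : Tendsto v atTop (𝓝 u))
    (hvs : ∀ᶠ k in atTop, v k ∈ W10 Ω s) {B : ℝ≥0∞} (hB : B ≠ ⊤)
    (hvB : ∀ᶠ k in atTop, eLpNorm (weakGradient (v k)) (ENNReal.ofReal s) (volOn Ω) ≤ B) :
    ∃ (w : ℕ → Euc N → ℝ) (V : ℕ → Euc N → Euc N), (∀ n, SobolevLimit Ω s (w n) (V n)) ∧
      (∀ n, eLpNorm (V n) (ENNReal.ofReal s) (volOn Ω) ≤ B) ∧
      (∀ K : Set (Euc N), IsCompact K → K ⊆ Ω →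
        Tendsto (fun n => eLpNorm (w n - fun x => u x) 1 (volume.restrict K)) atTop (𝓝 0)) ∧
      ∀ ε : ℝ, 0 < ε → ∃ n₀, ∀ n ≥ n₀, ∀ m ≥ n₀,
        ∫ x, √(1 + ‖V n x‖ ^ 2) ∂(volOn Ω) + ∫ x, √(1 + ‖V m x‖ ^ 2) ∂(volOn Ω) -
          2 * ∫ x, √(1 + ‖(1 / 2 : ℝ) • (V n x + V m x)‖ ^ 2) ∂(volOn Ω) < ε := by
  have := isFiniteMeasure_volOn hΩ
  have hsE : 1 ≤ ENNReal.ofReal s := ENNReal.one_le_ofReal.2 hs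
  obtain ⟨n₁, hn₁⟩ := eventually_atTop.1 (hvs.and hvB)
  -- Tails start at `max n n₁`, so that membership and the gradient bound hold for every element.
  set S : ℕ → Set ((Euc N → ℝ) × (Euc N → Euc N)) := fun n =>
    {z | ∃ k ≥ max n n₁, z = (fun x => v k x, weakGradient (v k))}
  set C := fun n => convexHull ℝ (S n)
  have hCS : ∀ n, C n ⊆ {z | SobolevLimit Ω s z.1 z.2 ∧
      eLpNorm z.2 (ENNReal.ofReal s) (volOn Ω) ≤ B} := fun n => by
    refine convexHull_min ?_ (convex_setOf_sobolevLimit hs B)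
    rintro _ ⟨k, hk, rfl⟩
    obtain ⟨h1, h2⟩ := hn₁ k ((le_max_right _ _).trans hk)
    exact ⟨(mem_W10_iff hΩ hs).1 h1, h2⟩
  set c := volOn Ω Set.univ ^ (1 / (1 : ℝ≥0∞).toReal - 1 / (ENNReal.ofReal s).toReal)
  have hc : c ≠ ⊤ := by
    refine ENNReal.rpow_ne_top_of_nonneg ?_ (measure_ne_top _ _)
    rw [ENNReal.toReal_ofReal (by linarith), ENNReal.toReal_one, sub_nonneg]
    exact one_div_le_one_div_of_le one_pos hs
  obtain ⟨z, hzC, hz⟩ := exists_seq_midpoint_defect_small (C := C)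
    (fun n => convex_convexHull ℝ _)
    (fun n => ⟨_, subset_convexHull ℝ _ ⟨max n n₁, le_rfl, rfl⟩⟩)
    (fun n m hnm => convexHull_mono fun z ⟨k, hk, hz⟩ =>
      ⟨k, (max_le_max_right n₁ hnm).trans hk, hz⟩)
    (fun z => ∫ x, √(1 + ‖z.2 x‖ ^ 2) ∂(volOn Ω))
    (B := (volOn Ω).real Set.univ + (B * c).toReal)
    (fun z => integral_nonneg fun x => Real.sqrt_nonneg _)
    (fun n z hz => by
      obtain ⟨h1, h2⟩ := hCS n hz
      refine integral_sqrt_one_add_norm_sq_le (h1.2.1.integrable hsE)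
        (ENNReal.mul_ne_top hB hc) ?_
      refine (eLpNorm_le_eLpNorm_mul_rpow_measure_univ hsE h1.2.1.1).trans ?_
      gcongr)
  refine ⟨fun n => (z n).1, fun n => (z n).2, fun n => (hCS n (hzC n)).1,
    fun n => (hCS n (hzC n)).2, fun K hK hKΩ => ?_, hz⟩
  have huK : AEStronglyMeasurable (fun x => u x) (volume.restrict K) :=
    (u.integrable_restrict hK hKΩ).1
  -- The choice of `z` does not depend on K: any selection from the hulls of the tails converges to
  -- u on every compact set.
  refine ENNReal.tendsto_nhds_zero.2 fun ε hε => ?_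
  obtain ⟨n₂, hn₂⟩ := eventually_atTop.1
    (ENNReal.tendsto_nhds_zero.1 (L1loc.tendsto_eLpNorm hv hK hKΩ) ε hε)
  filter_upwards [eventually_ge_atTop n₂] with n hn
  have hsub : S n ⊆ {z | AEStronglyMeasurable z.1 (volume.restrict K) ∧
      eLpNorm (z.1 - fun x => u x) 1 (volume.restrict K) ≤ ε} := by
    rintro _ ⟨k, hk, rfl⟩
    exact ⟨((v k).integrable_restrict hK hKΩ).1, hn₂ k (hn.trans ((le_max_left _ _).trans hk))⟩
  exact (convexHull_min hsub (convex_setOf_eLpNorm_sub_le huK ε) (hzC n)).2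

theorem ae_eq_of_tendsto_eLpNorm_of_tendsto {α F : Type*} [MeasurableSpace α] {μ : Measure α}
    [IsFiniteMeasure μ] [NormedAddCommGroup F] {p q : ℝ≥0∞} (hp : 1 ≤ p) (hq : 1 ≤ q)
    {w : ℕ → α → F} {f g : α → F} (hw : ∀ n, AEStronglyMeasurable (w n) μ)
    (hf : AEStronglyMeasurable f μ) (hg : AEStronglyMeasurable g μ)
    (hwf : Tendsto (fun n => eLpNorm (w n - f) p μ) atTop (𝓝 0))
    (hwg : Tendsto (fun n => eLpNorm (w n - g) q μ) atTop (𝓝 0)) : f =ᵐ[μ] g :=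
  tendstoInMeasure_ae_unique
    (tendstoInMeasure_of_tendsto_eLpNorm (zero_lt_one.trans_le hp).ne' hw hf hwf)
    (tendstoInMeasure_of_tendsto_eLpNorm (zero_lt_one.trans_le hq).ne' hw hg hwg)

/-- A limit in `L¹_loc(Ω)` of functions in `W^{1,s}_0(Ω)` whose gradients are bounded in `L^s(Ω)`
belongs to `W^{1,t}_0(Ω)`, `t < s`. -/
theorem mem_W10_of_tendsto {N : ℕ} {Ω : TopologicalSpace.Opens (Euc N)} (hN : N ≠ 0)
    (hΩ : Bornology.IsBounded (Ω : Set (Euc N))) {s t : ℝ} (ht : 1 ≤ t) (hts : t < s)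
    (hst : s ≤ t + 1) {v : ℕ → L1loc Ω} {u : L1loc Ω} (hv : Tendsto v atTop (𝓝 u))
    (hvs : ∀ᶠ k in atTop, v k ∈ W10 Ω s) {B : ℝ≥0∞} (hB : B ≠ ⊤)
    (hvB : ∀ᶠ k in atTop, eLpNorm (weakGradient (v k)) (ENNReal.ofReal s) (volOn Ω) ≤ B) :
    u ∈ W10 Ω t ∧ eLpNorm (weakGradient u) (ENNReal.ofReal t) (volOn Ω) ≤
      B * volOn Ω Set.univ ^ (1 / t - 1 / s) := by
  have := isFiniteMeasure_volOn hΩ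
  have htE : 1 ≤ ENNReal.ofReal t := ENNReal.one_le_ofReal.2 ht
  obtain ⟨R, hR, hdist⟩ := exists_pos_forall_dist_lt hΩ
  obtain ⟨w, V, hws, hVB, hwu, hdef⟩ :=
    exists_convex_combinations hΩ (ht.trans hts.le) hv hvs hB hvB
  have hwt : ∀ n, SobolevLimit Ω t (w n) (V n) := fun n =>
    (hws n).mono hΩ (by linarith) hts.le
  have hcauV := fun (ε : ℝ≥0∞) (hε : 0 < ε) => cauchy_eLpNorm_of_midpoint_defect_small
    ht hts hst (fun n => (hws n).2.1) hB hVB hdef hε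
  have hcauw : ∀ ε : ℝ≥0∞, 0 < ε → ∃ n₀, ∀ n ≥ n₀, ∀ m ≥ n₀,
      eLpNorm (w n - w m) (ENNReal.ofReal t) (volOn Ω) < ε := by
    intro ε hε
    have hR0 : ENNReal.ofReal R ≠ 0 := by simpa using hR
    -- The tolerance for gradients is ε / R because Poincaré's inequality multiplies it by R.
    obtain ⟨n₀, h⟩ := hcauV (ε / ENNReal.ofReal R) (ENNReal.div_pos hε.ne' ENNReal.ofReal_ne_top)
    refine ⟨n₀, fun n hn m hm => ?_⟩
    refine (((hwt n).sub ht (hwt m)).eLpNorm_le hN ht hR hdist).trans_lt ?_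
    rw [mul_comm]
    exact (ENNReal.lt_div_iff_mul_lt (Or.inl hR0) (Or.inl ENNReal.ofReal_ne_top)).1 (h n hn m hm)
  obtain ⟨G, hG, hGlim⟩ := exists_tendsto_eLpNorm_of_cauchy htE (fun n => (hwt n).2.1) hcauV
  obtain ⟨f, hf, hflim⟩ := exists_tendsto_eLpNorm_of_cauchy htE (fun n => (hwt n).1) hcauw
  -- On each compact K the functions `w n` converge to f in L^t and to u in L¹, hence to both in
  -- measure; compact sets exhaust Ω.
  have hfu : f =ᵐ[volOn Ω] fun x => u x := by
    refine TopologicalSpace.Opens.ae_eq_of_forall_isCompact fun K hK hKΩ => ?_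
    have hKle : volume.restrict K ≤ volOn Ω := Measure.restrict_mono hKΩ le_rfl
    have hKfin : IsFiniteMeasure (volume.restrict K) :=
      ⟨by rw [Measure.restrict_apply_univ]; exact hK.measure_lt_top⟩
    exact ae_eq_of_tendsto_eLpNorm_of_tendsto htE le_rfl
      (fun n => (hwt n).1.1.mono_measure hKle) (hf.1.mono_measure hKle)
      (u.integrable_restrict hK hKΩ).1
      (tendsto_of_tendsto_of_tendsto_of_le_of_le tendsto_const_nhds hflim (fun _ => zero_le)
        fun n => eLpNorm_mono_measure _ hKle)
      (hwu K hK hKΩ)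
  have hu : SobolevLimit Ω t (fun x => u x) G :=
    (SobolevLimit.of_tendsto ht hwt hf hG hflim hGlim).congr hfu (ae_eq_refl _)
  have hGu := hu.weakGradient_ae_eq hΩ ht
  refine ⟨(mem_W10_iff hΩ ht).2 (hu.congr (ae_eq_refl _) hGu), ?_⟩
  rw [← eLpNorm_congr_ae hGu]
  refine le_of_tendsto' (tendsto_eLpNorm_of_tendsto_eLpNorm_sub htE (fun n => (hwt n).2.1) hG
    hGlim) fun n => ?_
  refine (eLpNorm_le_eLpNorm_mul_rpow_measure_univ (ENNReal.ofReal_le_ofReal hts.le)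
    (hwt n).2.1.1).trans ?_
  rw [ENNReal.toReal_ofReal (by linarith), ENNReal.toReal_ofReal (by linarith)]
  gcongr
  exact hVB n

/-- In a one-point space every function on Ω is itself a test function and all gradients vanish. The
case is separate because Poincaré's inequality uses a unit vector. -/
theorem mem_W10_of_dimension_zero {Ω : TopologicalSpace.Opens (Euc 0)}
    (hΩ : Bornology.IsBounded (Ω : Set (Euc 0))) {p : ℝ} (hp : 1 ≤ p) (u : L1loc Ω) :
    u ∈ W10 Ω p := by
  have := isFiniteMeasure_volOn hΩ
  rw [mem_W10_iff hΩ hp]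
  have hmem : MemLp (fun x => u x) (ENNReal.ofReal p) (volOn Ω) :=
    MemLp.of_bound u.1.aestronglyMeasurable ‖u 0‖ (ae_of_all _ fun x => by
      rw [Subsingleton.elim x 0])
  refine ⟨hmem, (MemLp.zero (p := ENNReal.ofReal p)).ae_eq (ae_of_all _ fun x =>
    Subsingleton.elim _ _), fun ε hε => ?_⟩
  set φ : TestFunction Ω ℝ (⊤ : ℕ∞) :=
    ⟨(Ω : Set (Euc 0)).indicator fun x => u x,
      contDiff_of_differentiable_iteratedFDeriv fun _ _ x =>
        (hasFDerivAt_of_subsingleton _ x).differentiableAt,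
      (Set.toFinite _).isCompact, by
        rw [tsupport, closure_discrete]
        exact Set.support_indicator_subset⟩
  refine ⟨φ, ?_, ?_⟩
  · rw [eLpNorm_congr_ae (g := 0), eLpNorm_zero]
    · exact hε
    · filter_upwards [ae_restrict_mem Ω.isOpen.measurableSet] with x hx
      change u x - (Ω : Set (Euc 0)).indicator (fun x => u x) x = 0
      rw [Set.indicator_of_mem hx, sub_self]
  · rw [eLpNorm_congr_ae (g := 0) (ae_of_all _ fun x => Subsingleton.elim _ _), eLpNorm_zero]
    exact hε

/-! ### The liminf and limsup inequalities -/

/-- Monotonicity of the `L^s` norm in the exponent, with a constant depending only on `s` and `p`,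
for `s ≤ q ≤ p`. -/
theorem eLpNorm_le_mul_rpow_of_le {α F : Type*} [MeasurableSpace α] {μ : Measure α}
    [NormedAddCommGroup F] {c : ℝ≥0∞} (hμ : μ Set.univ ≤ c) (hc : 1 ≤ c) {s q p : ℝ}
    (hs : 0 < s) (hsq : s ≤ q) (hqp : q ≤ p) {f : α → F} (hf : AEStronglyMeasurable f μ) :
    eLpNorm f (ENNReal.ofReal s) μ ≤ eLpNorm f (ENNReal.ofReal q) μ * c ^ (1 / s - 1 / p) := by
  have hq : 0 < q := hs.trans_le hsq
  refine (eLpNorm_le_eLpNorm_mul_rpow_measure_univ (ENNReal.ofReal_le_ofReal hsq) hf).trans ?_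
  rw [ENNReal.toReal_ofReal hs.le, ENNReal.toReal_ofReal hq.le]
  gcongr
  refine (ENNReal.rpow_le_rpow hμ (sub_nonneg.2 (one_div_le_one_div_of_le hs hsq))).trans ?_
  exact ENNReal.rpow_le_rpow_of_exponent_le hc
    (sub_le_sub_left (one_div_le_one_div_of_le hq hqp) _)

theorem tendsto_rpow_one_div_sub_one_div {c : NNReal} (hc : c ≠ 0) {q : ℕ → ℝ} {p : ℝ}
    (hp : p ≠ 0) (hqp : Tendsto q atTop (𝓝 p)) :
    Tendsto (fun k => (c : ℝ≥0∞) ^ (1 / q k - 1 / p)) atTop (𝓝 1) := by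
  have h1 : Tendsto (fun k => 1 / q k - 1 / p) atTop (𝓝 0) := by
    have := (hqp.inv₀ hp).sub_const p⁻¹
    simpa using this
  have h2 := (tendsto_const_nhds (x := c)).nnrpow h1 (Or.inl hc)
  have h3 := ENNReal.tendsto_coe.2 h2
  simpa [ENNReal.coe_rpow_of_ne_zero hc] using h3

theorem energyMinus_le_liminf {N : ℕ} {Ω : TopologicalSpace.Opens (Euc N)}
    (hΩ : Bornology.IsBounded (Ω : Set (Euc N))) {p : ℝ} (hp : 1 < p) {q : ℕ → ℝ}
    (hq1 : ∀ h, 1 < q h) (hq : StrictMono q) (hqp : Tendsto q atTop (𝓝 p)) {u : L1loc Ω}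
    {v : ℕ → L1loc Ω} (hv : Tendsto v atTop (𝓝 u)) :
    energyMinus Ω p u ≤ liminf (fun h => energyMinus Ω (q h) (v h)) atTop := by
  have hp0 : 0 < p := by linarith
  rcases eq_or_ne N 0 with rfl | hN
  · rw [energyMinus, dirichletEnergyOn_of_mem hp0
      (W10_subset_W10minus hΩ (mem_W10_of_dimension_zero hΩ hp.le u)),
      eLpNorm_congr_ae (g := 0) (ae_of_all _ fun x => Subsingleton.elim _ _), eLpNorm_zero]
    exact zero_le
  have := isFiniteMeasure_volOn hΩ
  have hqle : ∀ k, q k ≤ p := hq.monotone.ge_of_tendsto hqp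
  have hqlt : ∀ k, q k < p := fun k => (hq k.lt_succ_self).trans_le (hqle _)
  obtain ⟨R, hR, hdist⟩ := exists_pos_forall_dist_lt hΩ
  -- With c at least 1 and at least the measure of Ω, Hölder factors are powers of c that increase
  -- with the exponent, and successive factors combine by adding exponents.
  set c : NNReal := max 1 (volOn Ω Set.univ).toNNReal
  have hc1 : (1 : ℝ≥0∞) ≤ c := by exact_mod_cast le_max_left _ _
  have hc0 : c ≠ 0 := (zero_lt_one.trans_le (le_max_left _ _)).ne'
  have hμc : volOn Ω Set.univ ≤ c := by
    rw [← ENNReal.coe_toNNReal (measure_ne_top (volOn Ω) Set.univ)]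
    exact_mod_cast le_max_right _ _
  -- Working with M strictly above the liminf provides a subsequence with energies below M and makes
  -- M nonzero, as the Fatou argument requires.
  refine le_of_forall_gt_imp_ge_of_dense fun M hM => ?_
  rcases eq_or_ne M ⊤ with rfl | hMtop
  · exact le_top
  have hM0 : M ≠ 0 := (zero_le.trans_lt hM).ne'
  obtain ⟨σ, hσ, hσM⟩ := extraction_of_frequently_atTop 
    (frequently_lt_of_liminf_lt (by isBoundedDefault) hM)
  have hmem : ∀ k, v (σ k) ∈ W10minus Ω (q (σ k)) := fun k =>
    mem_of_dirichletEnergyOn_lt_top ((hσM k).trans_le le_top)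
  have hgrad : ∀ k, eLpNorm (weakGradient (v (σ k))) (ENNReal.ofReal (q (σ k))) (volOn Ω) ≤ M :=
    fun k => by
      have := (hσM k).le
      rwa [energyMinus, dirichletEnergyOn_of_mem (by linarith [hq1 (σ k)]) (hmem k)] at this
  have key : ∀ t ∈ Set.Ioo 1 p, u ∈ W10 Ω t ∧
      eLpNorm (weakGradient u) (ENNReal.ofReal t) (volOn Ω) ≤ M * (c : ℝ≥0∞) ^ (1 / t - 1 / p) := by
    rintro t ⟨ht1, htp⟩
    -- Room between t and p is needed because the Cauchy argument loses exponent; the cap t + 1 is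
    -- the condition of `mem_W10_of_tendsto`.
    obtain ⟨s, hts, hs⟩ := exists_between (lt_min htp (lt_add_one t))
    obtain ⟨hsp, hst⟩ := lt_min_iff.1 hs
    have hs0 : 0 < s := by linarith
    have hev : ∀ᶠ k in atTop, s < q (σ k) :=
      (hqp.comp hσ.tendsto_atTop).eventually_const_lt hsp
    have hW : ∀ᶠ k in atTop, v (σ k) ∈ W10 Ω s := hev.mono fun k hk =>
      W10minus_subset_W10 (by linarith) hk (hmem k)
    have hctop : (c : ℝ≥0∞) ^ (1 / s - 1 / p) ≠ ⊤ :=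
      ENNReal.rpow_ne_top_of_nonneg (sub_nonneg.2 (one_div_le_one_div_of_le hs0 hsp.le))
        ENNReal.coe_ne_top
    obtain ⟨h1, h2⟩ := mem_W10_of_tendsto hN hΩ ht1.le hts hst.le (hv.comp hσ.tendsto_atTop) hW
      (ENNReal.mul_ne_top hMtop hctop) (by
        filter_upwards [hev, hW] with k hk hkW
        refine (eLpNorm_le_mul_rpow_of_le hμc hc1 hs0 hk.le (hqle _)
          ((mem_W10_iff hΩ (by linarith)).1 hkW).2.1.1).trans ?_
        gcongr
        exact hgrad k)
    refine ⟨h1, h2.trans ?_⟩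
    rw [mul_assoc]
    gcongr
    have he : 0 ≤ 1 / t - 1 / s := sub_nonneg.2 (one_div_le_one_div_of_le (by linarith) hts.le)
    -- The exponents telescope, so the auxiliary s disappears and the factor tends to 1 as t → p.
    calc (c : ℝ≥0∞) ^ (1 / s - 1 / p) * volOn Ω Set.univ ^ (1 / t - 1 / s)
        ≤ (c : ℝ≥0∞) ^ (1 / s - 1 / p) * (c : ℝ≥0∞) ^ (1 / t - 1 / s) := by gcongr
      _ = _ := by
          rw [← ENNReal.rpow_add _ _ (by exact_mod_cast hc0) ENNReal.coe_ne_top]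
          congr 1
          ring
  have hqmem : ∀ k, q k ∈ Set.Ioo 1 p := fun k => ⟨hq1 k, hqlt k⟩
  have hq0 : ∀ k, 0 < q k := fun k => by linarith [hq1 k]
  have hSob : ∀ k, SobolevLimit Ω (q k) (fun x => u x) (weakGradient u) := fun k =>
    (mem_W10_iff hΩ (hq1 k).le).1 (key _ (hqmem k)).1
  have hclim : Tendsto (fun k => M * (c : ℝ≥0∞) ^ (1 / q k - 1 / p)) atTop (𝓝 M) := by
    simpa using ENNReal.Tendsto.const_mul (a := M)
      (tendsto_rpow_one_div_sub_one_div hc0 hp0.ne' hqp) (Or.inr hMtop)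
  have hRlim : Tendsto (fun k => ENNReal.ofReal R * (M * (c : ℝ≥0∞) ^ (1 / q k - 1 / p))) atTop
      (𝓝 (ENNReal.ofReal R * M)) :=
    ENNReal.Tendsto.const_mul hclim (Or.inr ENNReal.ofReal_ne_top)
  have hgradp : eLpNorm (weakGradient u) (ENNReal.ofReal p) (volOn Ω) ≤ M :=
    eLpNorm_le_of_tendsto_exponent (hSob 0).2.1.1 hq0 hp0 hqp hM0 hMtop hclim
      fun k => (key _ (hqmem k)).2
  -- Poincaré's constant R does not depend on the exponent, so the bound on u also survives the
  -- limit q_k → p.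
  have hup : eLpNorm (fun x => u x) (ENNReal.ofReal p) (volOn Ω) ≤ ENNReal.ofReal R * M := by
    refine eLpNorm_le_of_tendsto_exponent (hSob 0).1.1 hq0 hp0 hqp
      (mul_ne_zero (by simpa using hR) hM0) (ENNReal.mul_ne_top ENNReal.ofReal_ne_top hMtop) hRlim
      fun k => ?_
    refine ((hSob k).eLpNorm_le hN (hq1 k).le hR hdist).trans ?_
    gcongr
    exact (key _ (hqmem k)).2
  have humem : u ∈ W10minus Ω p := by
    refine ⟨⟨⟨(hSob 0).1.1, hup.trans_lt (ENNReal.mul_lt_top ENNReal.ofReal_lt_top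
      hMtop.lt_top)⟩, weakGradient u, (hSob 0).hasWeakGradient hΩ (hq1 0).le,
      (hSob 0).2.1.1, hgradp.trans_lt hMtop.lt_top⟩, Set.mem_iInter₂.2 fun t ht => (key t ht).1⟩
  rwa [energyMinus, dirichletEnergyOn_of_mem hp0 humem]

theorem limsup_energy_le {N : ℕ} {Ω : TopologicalSpace.Opens (Euc N)}
    (hΩ : Bornology.IsBounded (Ω : Set (Euc N))) {p : ℝ} (hp : 1 < p) {q : ℕ → ℝ}
    (hq1 : ∀ h, 1 < q h) (hqlt : ∀ h, q h < p) (hqp : Tendsto q atTop (𝓝 p)) (u : L1loc Ω) :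
    limsup (fun h => energy Ω (q h) u) atTop ≤ energyMinus Ω p u := by
  have hp0 : 0 < p := by linarith
  by_cases hu : u ∈ W10minus Ω p
  swap
  · rw [energyMinus, dirichletEnergyOn, if_neg hu]
    exact le_top
  have := isFiniteMeasure_volOn hΩ
  set c : NNReal := max 1 (volOn Ω Set.univ).toNNReal
  have hc1 : (1 : ℝ≥0∞) ≤ c := by exact_mod_cast le_max_left _ _
  have hc0 : c ≠ 0 := (zero_lt_one.trans_le (le_max_left _ _)).ne'
  have hμc : volOn Ω Set.univ ≤ c := by
    rw [← ENNReal.coe_toNNReal (measure_ne_top (volOn Ω) Set.univ)]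
    exact_mod_cast le_max_right _ _
  have hW : ∀ h, u ∈ W10 Ω (q h) := fun h => W10minus_subset_W10 (hq1 h) (hqlt h) hu
  -- The factor tends to 1, which is nonzero, so the product converges without checking that the
  -- energy is finite.
  have hlim : Tendsto (fun h => energyMinus Ω p u * (c : ℝ≥0∞) ^ (1 / q h - 1 / p)) atTop
      (𝓝 (energyMinus Ω p u)) := by
    simpa using ENNReal.Tendsto.const_mul (a := energyMinus Ω p u)
      (tendsto_rpow_one_div_sub_one_div hc0 hp0.ne' hqp) (Or.inl one_ne_zero)
  rw [← hlim.limsup_eq]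
  refine limsup_le_limsup (.of_forall fun h => ?_)
  have hq0 : 0 < q h := by linarith [hq1 h]
  simp only [energy, energyMinus]
  rw [dirichletEnergyOn_of_mem hq0 (hW h), dirichletEnergyOn_of_mem hp0 hu]
  exact eLpNorm_le_mul_rpow_of_le hμc hc1 hq0 (hqlt h).le le_rfl
    ((mem_W10_iff hΩ (hq1 h).le).1 (hW h)).2.1.1

theorem theorem3p4 {N : ℕ} (Ω : TopologicalSpace.Opens (EuclideanSpace ℝ (Fin N)))
    (hΩ : Bornology.IsBounded (Ω : Set (EuclideanSpace ℝ (Fin N))))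
    (p : ℝ) (hp : 1 < p) (q : ℕ → ℝ) (hq1 : ∀ h, 1 < q h) (hq : StrictMono q)
    (hqp : Tendsto q atTop (𝓝 p)) :
    GammaConverges (fun h => energyMinus Ω (q h)) (energyMinus Ω p) ∧
      GammaConverges (fun h => energy Ω (q h)) (energyMinus Ω p) := by
  have hqlt : ∀ h, q h < p := fun h =>
    (hq h.lt_succ_self).trans_le (hq.monotone.ge_of_tendsto hqp _)
  have hle : ∀ h u, energyMinus Ω (q h) u ≤ energy Ω (q h) u := fun h u =>
    energyMinus_le_energy hΩ (by linarith [hq1 h]) u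
  have hinf : ∀ (u : L1loc Ω) (v : ℕ → L1loc Ω), Tendsto v atTop (𝓝 u) →
      energyMinus Ω p u ≤ liminf (fun h => energyMinus Ω (q h) (v h)) atTop := fun u v hv =>
    energyMinus_le_liminf hΩ hp hq1 hq hqp hv
  have hinf' : ∀ (u : L1loc Ω) (v : ℕ → L1loc Ω), Tendsto v atTop (𝓝 u) →
      energyMinus Ω p u ≤ liminf (fun h => energy Ω (q h) (v h)) atTop := fun u v hv =>
    (hinf u v hv).trans (liminf_le_liminf (.of_forall fun h => hle h (v h)))
  have hsup := limsup_energy_le hΩ hp hq1 hqlt hqp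
  refine ⟨⟨hinf, fun u => ⟨fun _ => u, tendsto_const_nhds, ?_⟩⟩,
    ⟨hinf', fun u => ⟨fun _ => u, tendsto_const_nhds, ?_⟩⟩⟩
  · exact tendsto_of_le_liminf_of_limsup_le (hinf u _ tendsto_const_nhds)
      ((limsup_le_limsup (.of_forall fun h => hle h u)).trans (hsup u))
  · exact tendsto_of_le_liminf_of_limsup_le (hinf' u _ tendsto_const_nhds) (hsup u)

end
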